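/- Let $X$ be a metric space and let $\Omega\subset X$ be a bounded domain, i.e. a bounded nonempty open connected set. Write $B(x,r)$ for the open ball. For connected sets $E\subset\Omega$ put $$d_M(x,y)=\inf\{\operatorname{diam}E : E\subset\Omega \text{ connected},\ x,y\in E\},\qquad x,y\in\Omega,$$ and let $\overline{\Omega}^M$ be the completion of the metric space $(\Omega,d_M)$. A metric space $Y$ is locally connected at $x\in Y$ if for every $r>0$ there is an open connected set $G$ with $x\in G\subset B(x,r)$, and it is locally connected if this holds at every $x\in Y$. Subsets of $X$ carry the induced metric. For $x_0\in\partial\Omega$ and $r>0$ let $H(r,x_0)$ be the set $B(x_0,r)\cap\Omega$ with all those of its connected components $C$ removed that satisfy $x_0\in\overline{C}$. Consider the following statements: (a) each $x_0\in\partial\Omega$ is locally accessible from $\Omega$, i.e. for every $r>0$ there is $\delta>0$ such that for every $x\in B(x_0,\delta)\cap\Omega$ there is a continuous curve $\gamma:[0,1]\to X$ with $\gamma([0,1))\subset B(x_0,r)\cap\Omega$, $\gamma(0)=x$ and $\gamma(1)=x_0$; (b) for every $x_0\in\partial\Omega$, the space $\Omega\cup\{x_0\}$ is locally connected at $x_0$;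 (c) for all $r>0$ and $x_0\in\partial\Omega$ we have $x_0\notin\overline{H(r,x_0)}$; (d) $\Omega$ is finitely connected at the boundary, i.e. for every $x_0\in\partial\Omega$ and $r>0$ there is an open set $G\subset X$ with $x_0\in G\subset B(x_0,r)$ such that $G\cap\Omega$ has only finitely many connected components; (e) $\overline{\Omega}^M$ is compact; (f) $\partial\Omega$ is locally connected; (g) $X\setminus\Omega$ is locally connected. If $X$ is proper (closed bounded sets are compact) and locally connected, then for every bounded domain $\Omega\subset X$ the following implications are true: $$\text{(e)}\Longleftrightarrow\text{(d)}\Longrightarrow\text{(c)}\Longleftrightarrow\text{(b)}\Longleftrightarrow\text{(a)}\qquad\text{and}\qquad\text{(f)}\Longrightarrow\text{(g)}.$$ No other implication is true, even for domains in $\mathbf{R}^3$ homeomorphic to a ball: if $P$ and $Q$ are two of the statements (a)--(g) such that $P\Rightarrow Q$ is not obtained by composing the implications displayed above, then there is a bounded domain $\Omega\subset\mathbf{R}^3=X$ (with the Euclidean metric), homeomorphic to an open ball, for which $P$ holds and $Q$ fails. -/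

import Mathlib

open Set Metric Topology

/-- Local connectedness of a space at a point: there are arbitrarily small open connected
neighbourhoods of the point. -/
def LocallyConnectedAt {Y : Type*} [MetricSpace Y] (x : Y) : Prop :=
  ∀ r : ℝ, 0 < r → ∃ G : Set Y, IsOpen G ∧ x ∈ G ∧ G ⊆ ball x r ∧ IsConnected G

/-- Local connectedness at every point is Mathlib's `LocallyConnectedSpace`. -/
theorem locallyConnectedSpace_iff_forall_at {Y : Type*} [MetricSpace Y] :
    LocallyConnectedSpace Y ↔ ∀ x : Y, LocallyConnectedAt x := by
  constructor
  · intro h x r hr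
    obtain ⟨G, ⟨hGo, hxG, hGc⟩, hGb⟩ :=
      (h.open_connected_basis x).mem_iff.1 (ball_mem_nhds x hr)
    exact ⟨G, hGo, hxG, hGb, hGc⟩
  · intro h
    refine ⟨fun x => ⟨fun t => ⟨fun ht => ?_, ?_⟩⟩⟩
    · obtain ⟨r, hr, hb⟩ := Metric.mem_nhds_iff.1 ht
      obtain ⟨G, hGo, hxG, hGb, hGc⟩ := h x r hr
      exact ⟨G, ⟨hGo, hxG, hGc⟩, hGb.trans hb⟩
    · rintro ⟨G, ⟨hGo, hxG, -⟩, hGt⟩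
      exact Filter.mem_of_superset (hGo.mem_nhds hxG) hGt

/-- The connected components of a subset `S`. -/
def componentsOf {X : Type*} [TopologicalSpace X] (S : Set X) : Set (Set X) :=
  {C | ∃ y ∈ S, C = connectedComponentIn S y}

/-- The part `H(r, x₀)` of `B(x₀, r) ∩ Ω` that remains when the components having `x₀` in their
closure are removed. -/
def remainder {X : Type*} [MetricSpace X] (Ω : Set X) (r : ℝ) (x₀ : X) : Set X :=
  (ball x₀ r ∩ Ω) \ ⋃₀ {C | C ∈ componentsOf (ball x₀ r ∩ Ω) ∧ x₀ ∈ closure C}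

/-- `x₀` is locally accessible from `Ω`. -/
def LocallyAccessible {X : Type*} [MetricSpace X] (Ω : Set X) (x₀ : X) : Prop :=
  ∀ r : ℝ, 0 < r → ∃ δ : ℝ, 0 < δ ∧ ∀ x ∈ ball x₀ δ ∩ Ω,
    ∃ γ : Path x x₀, ∀ t : unitInterval, t < 1 → γ t ∈ ball x₀ r ∩ Ω

/-- `Ω` is finitely connected at `x₀`. -/
def FinitelyConnectedAt {X : Type*} [MetricSpace X] (Ω : Set X) (x₀ : X) : Prop :=
  ∀ r : ℝ, 0 < r → ∃ G : Set X, IsOpen G ∧ x₀ ∈ G ∧ G ⊆ ball x₀ r ∧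
    (componentsOf (G ∩ Ω)).Finite

/-- A bounded domain: a bounded nonempty open connected set. -/
structure BoundedDomain (X : Type*) [MetricSpace X] where
  carrier : Set X
  isOpen : IsOpen carrier
  isConnected : IsConnected carrier
  isBounded : Bornology.IsBounded carrier

namespace BoundedDomain

variable {X : Type*} [MetricSpace X]

/-- The points of the domain, regarded as a space under the Mazurkiewicz distance. -/
def MazurkiewiczSpace (Ω : BoundedDomain X) : Type _ := {x : X // x ∈ Ω.carrier}

/-- The diameters of the connected subsets of the domain that contain both `x` and `y`. -/
def joiningDiams (Ω : BoundedDomain X) (x y : X) : Set ℝ :=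
  {δ | ∃ E : Set X, IsConnected E ∧ E ⊆ Ω.carrier ∧ x ∈ E ∧ y ∈ E ∧ δ = Metric.diam E}

/-- The Mazurkiewicz distance. -/
noncomputable def mazurkiewiczDist (Ω : BoundedDomain X) (x y : X) : ℝ :=
  sInf (Ω.joiningDiams x y)

theorem joiningDiams_bddBelow (Ω : BoundedDomain X) (x y : X) :
    BddBelow (Ω.joiningDiams x y) := by
  refine ⟨0, ?_⟩
  rintro δ ⟨E, -, -, -, -, rfl⟩
  exact Metric.diam_nonneg

theorem joiningDiams_nonempty (Ω : BoundedDomain X) {x y : X} (hx : x ∈ Ω.carrier)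
    (hy : y ∈ Ω.carrier) : (Ω.joiningDiams x y).Nonempty :=
  ⟨_, Ω.carrier, Ω.isConnected, subset_rfl, hx, hy, rfl⟩

theorem dist_le_mazurkiewiczDist (Ω : BoundedDomain X) {x y : X} (hx : x ∈ Ω.carrier)
    (hy : y ∈ Ω.carrier) : dist x y ≤ Ω.mazurkiewiczDist x y := by
  refine le_csInf (Ω.joiningDiams_nonempty hx hy) ?_
  rintro δ ⟨E, -, hEΩ, hxE, hyE, rfl⟩
  exact Metric.dist_le_diam_of_mem (Ω.isBounded.subset hEΩ) hxE hyE

theorem mazurkiewiczDist_self (Ω : BoundedDomain X) {x : X} (hx : x ∈ Ω.carrier) :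
    Ω.mazurkiewiczDist x x = 0 := by
  refine le_antisymm (csInf_le (Ω.joiningDiams_bddBelow x x) ?_) ?_
  · exact ⟨{x}, isConnected_singleton, singleton_subset_iff.2 hx, rfl, rfl, by simp⟩
  · simpa using Ω.dist_le_mazurkiewiczDist hx hx

theorem mazurkiewiczDist_comm (Ω : BoundedDomain X) (x y : X) :
    Ω.mazurkiewiczDist x y = Ω.mazurkiewiczDist y x := by
  have h : Ω.joiningDiams x y = Ω.joiningDiams y x := by
    ext δ
    constructor <;> rintro ⟨E, h1, h2, h3, h4, h5⟩ <;> exact ⟨E, h1, h2, h4, h3, h5⟩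
  rw [mazurkiewiczDist, mazurkiewiczDist, h]

theorem mazurkiewiczDist_triangle (Ω : BoundedDomain X) {x y z : X} (hx : x ∈ Ω.carrier)
    (hy : y ∈ Ω.carrier) (hz : z ∈ Ω.carrier) :
    Ω.mazurkiewiczDist x z ≤ Ω.mazurkiewiczDist x y + Ω.mazurkiewiczDist y z := by
  refine le_of_forall_pos_le_add fun ε hε => ?_
  obtain ⟨_, ⟨E, hE, hEΩ, hxE, hyE, rfl⟩, h1⟩ :=
    Real.lt_sInf_add_pos (Ω.joiningDiams_nonempty hx hy) (half_pos hε)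
  obtain ⟨_, ⟨F, hF, hFΩ, hyF, hzF, rfl⟩, h2⟩ :=
    Real.lt_sInf_add_pos (Ω.joiningDiams_nonempty hy hz) (half_pos hε)
  have h3 : Ω.mazurkiewiczDist x z ≤ Metric.diam (E ∪ F) :=
    csInf_le (Ω.joiningDiams_bddBelow x z)
      ⟨E ∪ F, hE.union ⟨y, hyE, hyF⟩ hF, union_subset hEΩ hFΩ, Or.inl hxE, Or.inr hzF, rfl⟩
  have h4 : Metric.diam (E ∪ F) ≤ Metric.diam E + Metric.diam F :=
    Metric.diam_union' ⟨y, hyE, hyF⟩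
  simp only [mazurkiewiczDist] at *
  linarith

noncomputable instance (Ω : BoundedDomain X) : MetricSpace Ω.MazurkiewiczSpace where
  dist x y := Ω.mazurkiewiczDist x.1 y.1
  dist_self x := Ω.mazurkiewiczDist_self x.2
  dist_comm x y := Ω.mazurkiewiczDist_comm x.1 y.1
  dist_triangle x y z := Ω.mazurkiewiczDist_triangle x.2 y.2 z.2
  eq_of_dist_eq_zero := by
    intro x y h
    refine Subtype.ext (dist_le_zero.1 ?_)
    exact (Ω.dist_le_mazurkiewiczDist x.2 y.2).trans h.le

/-- The completion of the domain with respect to the Mazurkiewicz distance. -/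
abbrev MazurkiewiczClosure (Ω : BoundedDomain X) : Type _ :=
  UniformSpace.Completion Ω.MazurkiewiczSpace

end BoundedDomain

/-- Labels of the seven boundary conditions. -/
inductive BoundaryCondition
  | a | b | c | d | e | f | g

/-- The seven boundary conditions on a bounded domain. -/
def BoundaryCondition.Holds {X : Type*} [MetricSpace X] (Ω : BoundedDomain X) :
    BoundaryCondition → Prop
  | .a => ∀ x₀ ∈ frontier Ω.carrier, LocallyAccessible Ω.carrier x₀
  | .b => ∀ x₀ ∈ frontier Ω.carrier,
      LocallyConnectedAt (⟨x₀, mem_insert x₀ Ω.carrier⟩ : ↥(insert x₀ Ω.carrier))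
  | .c => ∀ r : ℝ, 0 < r → ∀ x₀ ∈ frontier Ω.carrier, x₀ ∉ closure (remainder Ω.carrier r x₀)
  | .d => ∀ x₀ ∈ frontier Ω.carrier, FinitelyConnectedAt Ω.carrier x₀
  | .e => CompactSpace Ω.MazurkiewiczClosure
  | .f => LocallyConnectedSpace ↥(frontier Ω.carrier)
  | .g => LocallyConnectedSpace ↥(Ω.carrierᶜ)

/-- The arrows of the diagram `e ⇔ d ⇒ c ⇔ b ⇔ a` and `f ⇒ g`. -/
inductive BoundaryCondition.Arrow : BoundaryCondition → BoundaryCondition → Prop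
  | ed : Arrow .e .d
  | de : Arrow .d .e
  | dc : Arrow .d .c
  | cb : Arrow .c .b
  | bc : Arrow .b .c
  | ba : Arrow .b .a
  | ab : Arrow .a .b
  | fg : Arrow .f .g

/-! Implications. Conditions (e) and (d) both amount to total boundedness of the Mazurkiewicz
metric. A finite net selects finitely many components of `B(x₀, r) ∩ Ω` that contain all points of
`Ω` near `x₀`; conversely, under (d) the compact closure of `Ω` can be covered so that `Ω` is a
finite union of small connected sets, and one point from each is a net. Finitely many components
whose closures miss `x₀` stay away from `x₀`, so (d) gives (c). Under (c), `x₀` and the components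
touching it form a connected neighbourhood, which is (b). A curve ending at `x₀` sweeps out a
connected set touching `x₀`, so (a) gives (c).

The deep arrow is (b) ⇒ (a). The space `Ω ∪ {x₀}` is a G_δ, hence Polish, and a locally connected
Polish space is locally path connected (`locallyPathConnectedSpace_of_locallyConnectedSpace`); a
path to `x₀` is then stopped at its first arrival.

For (f) ⇒ (g), a component of the interior of the complement inside a small connected open set must
touch the boundary, and from there one continues inside the boundary.

Counterexamples. All are boxes `U × (-1, 0)` with a chimney over an open planar set `W`. Rescaling
the vertical fibres flattens the chimney (`nonempty_homeomorph_chimney_empty`), so the domain is a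
topological ball however wild `W` is. Hairs refute (d) ⇒ (g), sectors with a common vertex (c) ⇒
(d), shrinking plates (f) ⇒ (c), and separated shrinking columns (g) ⇒ (f). These four suffice,
because a separation persists when the first condition is weakened and the second strengthened. -/

open Filter

/-! ### Locally connected Polish spaces are locally path connected -/

section ChainPath

variable {X E : Type*} [MetricSpace X] [NormedAddCommGroup E] [NormedSpace ℝ E]

/-- Polygonal paths in `E` whose vertices are images of points of `X`, such that the end points of
every edge lie in a connected open subset of `X` of diameter at most `η`. -/
inductive ChainPath (ι : X → E) (η : ℝ) : ∀ {x y : X}, Path (ι x) (ι y) → Prop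
  | segment {x y : X} (V : Set X) (hV : IsPreconnected V) (hVo : IsOpen V)
      (hVη : ∀ a ∈ V, ∀ b ∈ V, dist a b ≤ η) (hx : x ∈ V) (hy : y ∈ V) :
      ChainPath ι η (Path.segment (ι x) (ι y))
  | trans {x y z : X} {γ : Path (ι x) (ι y)} {γ' : Path (ι y) (ι z)} (h : ChainPath ι η γ)
      (h' : ChainPath ι η γ') : ChainPath ι η (γ.trans γ')

theorem dist_pathSegment_le (a b : E) (t : unitInterval) :
    dist (Path.segment a b t) a ≤ dist a b := by
  rw [Path.segment_apply, dist_lineMap_left, Real.norm_of_nonneg t.2.1]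
  exact mul_le_of_le_one_left dist_nonneg t.2.2

theorem Path.trans_forall {Y : Type*} [TopologicalSpace Y] {p : Y → Prop} {x y z : Y}
    {γ : Path x y} {γ' : Path y z} (h : ∀ t, p (γ t)) (h' : ∀ t, p (γ' t)) (t : unitInterval) :
    p (γ.trans γ' t) := by
  rw [Path.trans_apply]
  split_ifs
  exacts [h _, h' _]

theorem ChainPath.exists_dist_le {ι : X → E} (hι : Isometry ι) {η : ℝ} {x y : X}
    {γ : Path (ι x) (ι y)} (h : ChainPath ι η γ) :
    ∀ t, ∃ v, dist (γ t) (ι v) ≤ η := by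
  induction h with
  | @segment x y V _ _ hVη hx hy =>
    exact fun t => ⟨x, (dist_pathSegment_le _ _ t).trans ((hι.dist_eq x y).trans_le (hVη x hx y hy))⟩
  | trans _ _ h h' => exact Path.trans_forall (p := fun e => ∃ v, dist e (ι v) ≤ η) h h'

/-- Being joined by such a chain is transitive and holds between nearby points of `V`, where one
segment suffices; connectedness of `V` spreads it to all pairs. -/
theorem exists_chainPath [LocallyConnectedSpace X] {ι : X → E} (hι : Isometry ι) {η : ℝ}
    (hη : 0 < η) {V : Set X} (hV : IsPreconnected V) (hVo : IsOpen V) {x y : X} (hx : x ∈ V)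
    (hy : y ∈ V) :
    ∃ γ : Path (ι x) (ι y), ChainPath ι η γ ∧ ∀ t, ∃ v ∈ V, dist (γ t) (ι v) ≤ η := by
  refine hV.induction₂' (fun x y => ∃ γ : Path (ι x) (ι y), ChainPath ι η γ ∧
    ∀ t, ∃ v ∈ V, dist (γ t) (ι v) ≤ η) ?_ ?_ hx hy
  · intro x hx
    obtain ⟨N, hN, hNo, hxN, hNc⟩ := locallyConnectedSpace_iff_subsets_isOpen_isConnected.1 ‹_› x
      (V ∩ ball x (η / 2)) (inter_mem (hVo.mem_nhds hx) (ball_mem_nhds x (half_pos hη)))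
    have hNη : ∀ a ∈ N, ∀ b ∈ N, dist a b ≤ η := fun a ha b hb => by
      linarith [dist_triangle_right a b x, mem_ball.1 (hN ha).2, mem_ball.1 (hN hb).2]
    have key : ∀ a ∈ N, ∀ b ∈ N, ∃ γ : Path (ι a) (ι b), ChainPath ι η γ ∧
        ∀ t, ∃ v ∈ V, dist (γ t) (ι v) ≤ η := fun a ha b hb =>
      ⟨Path.segment (ι a) (ι b), .segment N hNc.isPreconnected hNo hNη ha hb, fun t =>
        ⟨a, (hN ha).1, (dist_pathSegment_le _ _ t).trans
          ((hι.dist_eq a b).trans_le (hNη a ha b hb))⟩⟩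
    filter_upwards [mem_nhdsWithin_of_mem_nhds (hNo.mem_nhds hxN)] with y hy
    exact ⟨key x hxN y hy, key y hy x hxN⟩
  · rintro x y z - - - ⟨γ, hγ, h⟩ ⟨γ', hγ', h'⟩
    exact ⟨γ.trans γ', hγ.trans hγ',
      Path.trans_forall (p := fun e => ∃ v ∈ V, dist e (ι v) ≤ η) h h'⟩

/-- Each edge is replaced, on the same parameter interval, by a finer chain near its own set `V`.
The 3 counts the edge, the distance in `V` to a nearby vertex, and the deviation `η' ≤ η` of the new
chain. -/
theorem ChainPath.refine [LocallyConnectedSpace X] {ι : X → E} (hι : Isometry ι) {η η' : ℝ}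
    (hη' : 0 < η') (hle : η' ≤ η) {x y : X} {γ : Path (ι x) (ι y)} (h : ChainPath ι η γ) :
    ∃ γ' : Path (ι x) (ι y), ChainPath ι η' γ' ∧ ∀ t, dist (γ t) (γ' t) ≤ 3 * η := by
  induction h with
  | @segment x y V hV hVo hVη hx hy =>
    obtain ⟨γ', hγ', h⟩ := exists_chainPath hι hη' hV hVo hx hy
    refine ⟨γ', hγ', fun t => ?_⟩
    obtain ⟨v, hv, hvt⟩ := h t
    have h1 := dist_pathSegment_le (ι x) (ι y) t
    have h2 := hVη x hx v hv
    have h3 := hVη x hx y hy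
    rw [← hι.dist_eq] at h2 h3
    linarith [dist_triangle4 (Path.segment (ι x) (ι y) t) (ι x) (ι v) (γ' t),
      dist_comm (ι v) (γ' t)]
  | @trans x y z γ₁ γ₂ _ _ h h' =>
    obtain ⟨γ₁', hc, hd⟩ := h
    obtain ⟨γ₂', hc', hd'⟩ := h'
    refine ⟨γ₁'.trans γ₂', hc.trans hc', fun t => ?_⟩
    rw [Path.trans_apply, Path.trans_apply]
    split_ifs
    exacts [hd _, hd' _]

/-- Refining with tolerances `η / 2 ^ n` gives a uniformly Cauchy sequence with total displacement
at most `6 * η`; the initial segment contributes one more `η`. The limit lies in the range of `ι`,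
which is closed since `X` is complete and is approached within `η / 2 ^ n`. -/
theorem exists_path_dist_le [CompleteSpace X] [LocallyConnectedSpace X] [CompleteSpace E]
    {ι : X → E} (hι : Isometry ι) {η : ℝ} (hη : 0 < η) {V : Set X} (hV : IsPreconnected V)
    (hVo : IsOpen V) (hVη : ∀ a ∈ V, ∀ b ∈ V, dist a b ≤ η) {x y : X} (hx : x ∈ V) (hy : y ∈ V) :
    ∃ γ : Path x y, ∀ t, dist (γ t) x ≤ 7 * η := by
  have hpos : ∀ n : ℕ, 0 < η / 2 ^ n := fun n => by positivity
  choose! F hF hFd using fun (n : ℕ) (γ : Path (ι x) (ι y)) (h : ChainPath ι (η / 2 ^ n) γ) =>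
    h.refine hι (hpos (n + 1)) (by gcongr <;> simp)
  let γ₀ : Path (ι x) (ι y) := Path.segment (ι x) (ι y)
  let G : ℕ → Path (ι x) (ι y) := fun n => Nat.rec γ₀ F n
  have hG : ∀ n, ChainPath ι (η / 2 ^ n) (G n) := fun n => by
    induction n with
    | zero => exact .segment V hV hVo (by simpa using hVη) hx hy
    | succ n ih => exact hF n _ ih
  let g : ℕ → C(unitInterval, E) := fun n => (G n).toContinuousMap
  have hg : ∀ n, dist (g n) (g (n + 1)) ≤ (6 * η) / 2 / 2 ^ n := fun n => by
    rw [ContinuousMap.dist_le (by positivity)]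
    exact fun t => (hFd n _ (hG n) t).trans (le_of_eq (by ring))
  obtain ⟨f, hf⟩ := cauchySeq_tendsto_of_complete (cauchySeq_of_le_geometric_two hg)
  have hft : ∀ t, Tendsto (fun n => G n t) atTop (𝓝 (f t)) := fun t =>
    ((continuous_eval_const t).tendsto f).comp hf
  have hη0 : Tendsto (fun n : ℕ => η / 2 ^ n) atTop (𝓝 0) := by
    simpa [div_eq_mul_inv] using
      (tendsto_pow_atTop_nhds_zero_of_lt_one (r := (2 : ℝ)⁻¹) (by norm_num)
        (by norm_num)).const_mul η
  have hrange : ∀ t, f t ∈ range ι := fun t => by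
    rw [← hι.isClosedEmbedding.isClosed_range.closure_eq, Metric.mem_closure_iff]
    intro ε hε
    obtain ⟨n, hn, hn'⟩ := ((hη0.eventually (gt_mem_nhds (half_pos hε))).and
      ((hft t).eventually (ball_mem_nhds _ (half_pos hε)))).exists
    obtain ⟨v, hv⟩ := (hG n).exists_dist_le hι t
    refine ⟨ι v, mem_range_self v, ?_⟩
    linarith [dist_triangle_left (f t) (ι v) (G n t), mem_ball.1 hn']
  choose p hp using hrange
  have hends : f 0 = ι x ∧ f 1 = ι y :=
    ⟨tendsto_nhds_unique (hft 0) (by simp), tendsto_nhds_unique (hft 1) (by simp)⟩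
  refine ⟨⟨⟨p, ?_⟩, hι.injective (by rw [hp, hends.1]), hι.injective (by rw [hp, hends.2])⟩,
    fun t => ?_⟩
  · rw [hι.isEmbedding.continuous_iff]
    exact f.continuous.congr fun t => (hp t).symm
  · have h1 : dist (g 0) f ≤ 6 * η := dist_le_of_le_geometric_two_of_tendsto₀ hg hf
    have h2 := (ContinuousMap.dist_apply_le_dist t).trans h1
    have h3 := (dist_pathSegment_le (ι x) (ι y) t).trans
      ((hι.dist_eq x y).trans_le (hVη x hx y hy))
    change dist (p t) x ≤ _
    rw [← hι.dist_eq, hp]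
    change dist (γ₀ t) (f t) ≤ _ at h2
    linarith [dist_triangle_left (f t) (ι x) (γ₀ t)]

end ChainPath

theorem locallyPathConnectedSpace_of_locallyConnectedSpace (X : Type*) [TopologicalSpace X]
    [PolishSpace X] [LocallyConnectedSpace X] : LocallyPathConnectedSpace X := by
  let := TopologicalSpace.upgradeIsCompletelyMetrizable X
  refine ⟨fun x => nhds_basis_ball.to_hasBasis (fun r hr => ?_) fun s hs => ?_⟩
  · refine ⟨pathComponentIn (ball x r) x, ⟨?_, isPathConnected_pathComponentIn (mem_ball_self hr)⟩,
      pathComponentIn_subset⟩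
    -- Radius `r / 16` gives mutual distances at most `r / 8`, and `7 * (r / 8) < r`.
    obtain ⟨V, hVb, hVo, hxV, hVc⟩ := locallyConnectedSpace_iff_subsets_isOpen_isConnected.1 ‹_› x
      (ball x (r / 16)) (ball_mem_nhds x (by positivity))
    refine mem_of_superset (hVo.mem_nhds hxV) fun y hy => ?_
    obtain ⟨γ, hγ⟩ := exists_path_dist_le (kuratowskiEmbedding.isometry X)
      (show 0 < r / 8 by positivity) hVc.isPreconnected hVo (fun a ha b hb => by
        linarith [dist_triangle_right a b x, mem_ball.1 (hVb ha), mem_ball.1 (hVb hb)]) hxV hy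
    exact ⟨γ, fun t => mem_ball.2 (by linarith [hγ t])⟩
  · exact Metric.mem_nhds_iff.1 hs.1

/-- The union of an open set and a point in a Polish metric space is Polish. -/
theorem polishSpace_insert {X : Type*} [MetricSpace X] [PolishSpace X] {U : Set X}
    (hU : IsOpen U) (x : X) : PolishSpace ↥(insert x U) := by
  -- The set is the intersection of the open sets `T n`, and the diagonal embeds it as a closed
  -- subset of their product.
  let T : ℕ → Set X := fun n => U ∪ ball x (1 / (n + 1))
  have hT : ∀ n, IsOpen (T n) := fun n => hU.union isOpen_ball
  have : ∀ n, PolishSpace (T n) := fun n => (hT n).polishSpace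
  have hmem : ∀ n, insert x U ⊆ T n := fun n => insert_subset
    (Or.inr (mem_ball_self (by positivity))) subset_union_left
  let D : ↥(insert x U) → ∀ n, T n := fun y n => ⟨y, hmem n y.2⟩
  have hD : Continuous D := continuous_pi fun n => continuous_subtype_val.subtype_mk _
  have hproj : ∀ n, Continuous fun u : ∀ n, T n => (u n : X) := fun n =>
    continuous_subtype_val.comp (continuous_apply n)
  refine IsClosedEmbedding.polishSpace (f := D) ⟨⟨?_, fun a b h => ?_⟩, ?_⟩
  · exact IsInducing.of_comp hD (hproj 0) IsInducing.subtypeVal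
  · exact Subtype.ext (congrArg (fun u : ∀ n, T n => (u 0 : X)) h)
  · have : range D = ⋂ n, {u | (u n : X) = u 0} := by
      ext u
      simp only [mem_range, mem_iInter, mem_ofPred_eq]
      constructor
      · rintro ⟨y, rfl⟩ n
        rfl
      · intro h
        have hu : (u 0 : X) ∈ insert x U := by
          by_contra hn
          rw [mem_insert_iff, not_or] at hn
          obtain ⟨n, hn'⟩ := exists_nat_one_div_lt (dist_pos.2 hn.1)
          have := (u n).2
          rw [h n] at this
          exact this.elim hn.2 fun hb => lt_asymm hn' (mem_ball.1 hb)
        exact ⟨⟨u 0, hu⟩, funext fun n => Subtype.ext (h n).symm⟩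
    rw [this]
    exact isClosed_iInter fun n => isClosed_eq (hproj n) (hproj 0)

/-! ### The implications between the boundary conditions -/

section Implications

variable {X : Type*} [MetricSpace X]

theorem connectedComponentIn_mem_componentsOf {S : Set X} {y : X} (hy : y ∈ S) :
    connectedComponentIn S y ∈ componentsOf S := ⟨y, hy, rfl⟩

theorem mem_remainder_iff {Ω : Set X} {r : ℝ} {x₀ y : X} :
    y ∈ remainder Ω r x₀ ↔
      y ∈ ball x₀ r ∩ Ω ∧ x₀ ∉ closure (connectedComponentIn (ball x₀ r ∩ Ω) y) := by
  refine and_congr_right fun hy => not_congr ⟨?_, fun h =>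
    ⟨_, ⟨connectedComponentIn_mem_componentsOf hy, h⟩, mem_connectedComponentIn hy⟩⟩
  rintro ⟨_, ⟨⟨z, -, rfl⟩, hx⟩, hyz⟩
  rwa [← connectedComponentIn_eq hyz]

theorem notMem_remainder_of_isPreconnected {Ω C : Set X} {r : ℝ} {x₀ y : X}
    (hC : IsPreconnected C) (hCΩ : C ⊆ ball x₀ r ∩ Ω) (hy : y ∈ C) (hx₀ : x₀ ∈ closure C) :
    y ∉ remainder Ω r x₀ := fun h =>
  (mem_remainder_iff.1 h).2 (closure_mono (hC.subset_connectedComponentIn hy hCΩ) hx₀)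

theorem notMem_closure_remainder_of_locallyAccessible {Ω : Set X} {x₀ : X}
    (h : LocallyAccessible Ω x₀) {r : ℝ} (hr : 0 < r) : x₀ ∉ closure (remainder Ω r x₀) := by
  obtain ⟨δ, hδ, H⟩ := h r hr
  rw [mem_closure_iff_frequently, not_frequently]
  filter_upwards [ball_mem_nhds x₀ hδ] with y hyδ hy
  obtain ⟨γ, hγ⟩ := H y ⟨hyδ, hy.1.2⟩
  refine notMem_remainder_of_isPreconnected (C := γ '' Iio 1)
    (isPreconnected_Iio.image _ γ.continuous.continuousOn) ?_ ⟨0, mem_Iio.2 zero_lt_one, γ.source⟩ ?_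
    hy
  · rintro _ ⟨t, ht, rfl⟩
    exact hγ t ht
  · have h1 : (1 : unitInterval) ∈ closure (Iio 1) := by
      rw [closure_Iio' ⟨0, mem_Iio.2 zero_lt_one⟩]
      exact mem_Iic.2 le_rfl
    simpa using image_closure_subset_closure_image γ.continuous (mem_image_of_mem γ h1)

/-- The neighbourhood consists of `x₀` and all components touching it. It is open at `x₀` because
the remainder stays away, and elsewhere because components of open sets are open. -/
theorem locallyConnectedAt_insert_of_notMem_closure_remainder [LocallyConnectedSpace X]
    {Ω : Set X} (hΩ : IsOpen Ω) {x₀ : X} (h : ∀ r > 0, x₀ ∉ closure (remainder Ω r x₀)) :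
    LocallyConnectedAt (⟨x₀, mem_insert x₀ Ω⟩ : ↥(insert x₀ Ω)) := by
  intro r hr
  let D : X → Set X := connectedComponentIn (ball x₀ r ∩ Ω)
  let G : Set X := insert x₀ {y | y ∈ ball x₀ r ∩ Ω ∧ x₀ ∈ closure (D y)}
  have hopen : IsOpen (ball x₀ r ∩ Ω) := isOpen_ball.inter hΩ
  have hDG : ∀ y ∈ G, y ≠ x₀ → D y ⊆ G := by
    rintro y (rfl | hy) hne z hz
    · exact absurd rfl hne
    · refine Or.inr ⟨connectedComponentIn_subset _ _ hz, ?_⟩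
      rw [show D z = D y from (connectedComponentIn_eq hz).symm]
      exact hy.2
  refine ⟨Subtype.val ⁻¹' G, isOpen_iff_mem_nhds.2 ?_, Or.inl rfl, ?_,
    ⟨⟨x₀, mem_insert _ _⟩, Or.inl rfl⟩, ?_⟩
  · rintro ⟨y, hyΩ⟩ hyG
    by_cases hyx : y = x₀
    · subst hyx
      have h' := h r hr
      rw [mem_closure_iff_frequently, not_frequently] at h'
      have h'' := ((continuous_subtype_val (p := (· ∈ insert y Ω))).tendsto ⟨y, hyΩ⟩).eventually
        (h'.and (ball_mem_nhds y hr))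
      filter_upwards [h''] with z hz
      rcases z.2 with hzy | hz'
      · exact Or.inl hzy
      · rw [mem_remainder_iff, not_and, not_not] at hz
        exact Or.inr ⟨⟨hz.2, hz'⟩, hz.1 ⟨hz.2, hz'⟩⟩
    · have hyB : y ∈ ball x₀ r ∩ Ω := (hyG.resolve_left hyx).1
      exact mem_of_superset (continuous_subtype_val.continuousAt.preimage_mem_nhds
        (hopen.connectedComponentIn.mem_nhds (mem_connectedComponentIn hyB)))
        (preimage_mono (hDG y hyG hyx))
  · rintro ⟨y, hyΩ⟩ (hy | hy)
    · exact mem_ball.2 (by rw [Subtype.dist_eq]; simpa [show y = x₀ from hy] using hr)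
    · exact hy.1.1
  · have hG : IsPreconnected G := by
      refine isPreconnected_of_forall x₀ fun y hy => ?_
      by_cases hyx : y = x₀
      · exact ⟨{x₀}, by simp [G], rfl, hyx, isPreconnected_singleton⟩
      · have hy' := hy.resolve_left hyx
        exact ⟨insert x₀ (D y), insert_subset (Or.inl rfl) (hDG y hy hyx), mem_insert _ _,
          Or.inr (mem_connectedComponentIn hy'.1),
          isPreconnected_connectedComponentIn.subset_closure (subset_insert _ _)
            (insert_subset hy'.2 subset_closure)⟩
    have hsub : G ⊆ insert x₀ Ω := insert_subset_insert fun y hy => hy.1.2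
    rw [← IsInducing.subtypeVal.isPreconnected_image, Subtype.image_preimage_coe,
      inter_eq_right.2 hsub]
    exact hG

theorem locallyAccessible_of_locallyConnectedAt_insert [LocallyConnectedSpace X] [PolishSpace X]
    {Ω : Set X} (hΩ : IsOpen Ω) {x₀ : X} (hx₀ : x₀ ∉ Ω)
    (h : LocallyConnectedAt (⟨x₀, mem_insert x₀ Ω⟩ : ↥(insert x₀ Ω))) :
    LocallyAccessible Ω x₀ := by
  have hlc : LocallyConnectedSpace ↥(insert x₀ Ω) := by
    refine locallyConnectedSpace_iff_forall_at.2 ?_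
    rintro ⟨x, hx | hx⟩
    · obtain rfl : x = x₀ := hx
      exact h
    · intro r hr
      obtain ⟨N, hN, hNo, hxN, hNc⟩ := locallyConnectedSpace_iff_subsets_isOpen_isConnected.1 ‹_› x
        (Ω ∩ ball x r) (inter_mem (hΩ.mem_nhds hx) (ball_mem_nhds x hr))
      refine ⟨Subtype.val ⁻¹' N, hNo.preimage continuous_subtype_val, hxN, fun y hy => (hN hy).2,
        ⟨⟨x, Or.inr hx⟩, hxN⟩, ?_⟩
      rw [← IsInducing.subtypeVal.isPreconnected_image, Subtype.image_preimage_coe,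
        inter_eq_right.2 ((hN.trans inter_subset_left).trans (subset_insert x₀ Ω))]
      exact hNc.isPreconnected
  have := polishSpace_insert hΩ x₀
  have := locallyPathConnectedSpace_of_locallyConnectedSpace ↥(insert x₀ Ω)
  intro r hr
  let p : ↥(insert x₀ Ω) := ⟨x₀, mem_insert x₀ Ω⟩
  obtain ⟨δ, hδ, hb⟩ := Metric.mem_nhds_iff.1 (pathComponentIn_mem_nhds (ball_mem_nhds p hr))
  refine ⟨δ, hδ, fun x hx => ?_⟩
  obtain ⟨γ, hγ⟩ := (JoinedIn.symm (hb (show (⟨x, Or.inr hx.2⟩ : ↥(insert x₀ Ω)) ∈ ball p δ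
    from hx.1)))
  have hcl : IsClosed {t | γ t = p} := isClosed_eq γ.continuous continuous_const
  -- First arrival at `x₀`; the path is reparametrised to stop there, so that earlier values lie in
  -- `Ω`.
  let t₀ := sInf {t | γ t = p}
  have ht₀ : γ t₀ = p := hcl.csInf_mem ⟨1, γ.target⟩ (OrderBot.bddBelow _)
  have hpos : 0 < t₀ := by
    refine lt_of_le_of_ne unitInterval.nonneg' fun h0 => hx₀ ?_
    rw [← h0, γ.source] at ht₀
    rw [← show x = x₀ from congrArg Subtype.val ht₀]
    exact hx.2
  refine ⟨⟨⟨fun t => (γ (t * t₀)).1, by fun_prop⟩, by simp, by simp [ht₀, p]⟩, fun t ht => ?_⟩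
  refine ⟨hγ (t * t₀), (γ (t * t₀)).2.resolve_left fun h => ?_⟩
  have hle : t₀ ≤ t * t₀ := csInf_le (OrderBot.bddBelow _) (Subtype.ext h)
  have h1 : (t : ℝ) < 1 := ht
  have h2 : (0 : ℝ) < t₀ := hpos
  have h3 : (t₀ : ℝ) ≤ t * t₀ := hle
  nlinarith

/-- Applied to finite families: near `x` only those members are met that have `x` in their closure.
-/
theorem eventually_mem_imp_mem_closure {Y : Type*} [TopologicalSpace Y] (S : Set Y) (x : Y) :
    ∀ᶠ y in 𝓝 x, y ∈ S → x ∈ closure S := by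
  by_cases hx : x ∈ closure S
  · exact Eventually.of_forall fun _ _ => hx
  · filter_upwards [isClosed_closure.isOpen_compl.mem_nhds hx] with y hy hyS
    exact absurd (subset_closure hyS) hy

theorem notMem_closure_remainder_of_finitelyConnectedAt {Ω : Set X} {x₀ : X}
    (h : FinitelyConnectedAt Ω x₀) {r : ℝ} (hr : 0 < r) : x₀ ∉ closure (remainder Ω r x₀) := by
  obtain ⟨G, hG, hxG, hGr, hfin⟩ := h r hr
  rw [mem_closure_iff_frequently, not_frequently]
  filter_upwards [hG.mem_nhds hxG, (eventually_all_finite hfin).2 fun C _ =>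
    eventually_mem_imp_mem_closure C x₀] with y hyG hyC hy
  have hyS : y ∈ G ∩ Ω := ⟨hyG, hy.1.2⟩
  exact notMem_remainder_of_isPreconnected isPreconnected_connectedComponentIn
    ((connectedComponentIn_subset _ _).trans (inter_subset_inter_left _ hGr))
    (mem_connectedComponentIn hyS)
    (hyC _ (connectedComponentIn_mem_componentsOf hyS) (mem_connectedComponentIn hyS)) hy

theorem finite_componentsOf_sUnion {F : Set (Set X)} (hF : F.Finite)
    (hpre : ∀ A ∈ F, IsPreconnected A) : (componentsOf (⋃₀ F)).Finite := by
  have : ∀ A ∈ F, ∃ C, ∀ y ∈ A, connectedComponentIn (⋃₀ F) y = C := by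
    intro A hA
    rcases A.eq_empty_or_nonempty with rfl | ⟨x, hx⟩
    · exact ⟨∅, fun y hy => absurd hy (notMem_empty y)⟩
    · exact ⟨connectedComponentIn (⋃₀ F) x, fun y hy => (connectedComponentIn_eq
        ((hpre A hA).subset_connectedComponentIn hx (subset_sUnion_of_mem hA) hy)).symm⟩
  choose! c hc using this
  refine (hF.image c).subset ?_
  rintro _ ⟨y, ⟨A, hA, hyA⟩, rfl⟩
  exact ⟨A, hA, (hc A hA y hyA).symm⟩

namespace BoundedDomain

theorem dist_le_diam (Ω : BoundedDomain X) {E : Set X} (hE : IsPreconnected E)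
    (hEΩ : E ⊆ Ω.carrier) (x y : Ω.MazurkiewiczSpace) (hx : x.1 ∈ E) (hy : y.1 ∈ E) :
    dist x y ≤ diam E :=
  csInf_le (Ω.joiningDiams_bddBelow _ _) ⟨E, ⟨⟨_, hx⟩, hE⟩, hEΩ, hx, hy, rfl⟩

theorem exists_isConnected_of_dist_lt (Ω : BoundedDomain X) {x y : Ω.MazurkiewiczSpace} {ρ : ℝ}
    (h : dist x y < ρ) :
    ∃ E, IsConnected E ∧ E ⊆ Ω.carrier ∧ x.1 ∈ E ∧ y.1 ∈ E ∧ diam E < ρ := by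
  obtain ⟨_, ⟨E, h1, h2, h3, h4, rfl⟩, h5⟩ :=
    exists_lt_of_csInf_lt (Ω.joiningDiams_nonempty x.2 y.2) h
  exact ⟨E, h1, h2, h3, h4, h5⟩

theorem compactSpace_mazurkiewiczClosure_iff (Ω : BoundedDomain X) :
    CompactSpace Ω.MazurkiewiczClosure ↔ TotallyBounded (univ : Set Ω.MazurkiewiczSpace) := by
  constructor
  · intro h
    simpa using totallyBounded_preimage
      (UniformSpace.Completion.isUniformInducing_coe Ω.MazurkiewiczSpace)
      (isCompact_univ (X := Ω.MazurkiewiczClosure)).totallyBounded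
  · intro h
    have h' := h.image (UniformSpace.Completion.uniformContinuous_coe Ω.MazurkiewiczSpace)
    refine ⟨?_⟩
    have := h'.closure.isCompact_of_isClosed isClosed_closure
    rwa [image_univ, UniformSpace.Completion.denseRange_coe.closure_range] at this

theorem finitelyConnectedAt_of_totallyBounded [LocallyConnectedSpace X] (Ω : BoundedDomain X)
    (h : TotallyBounded (univ : Set Ω.MazurkiewiczSpace)) (x₀ : X) :
    FinitelyConnectedAt Ω.carrier x₀ := by
  intro r hr
  obtain ⟨t, ht, hcov⟩ := Metric.totallyBounded_iff.1 h (r / 2) (half_pos hr)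
  let D : Ω.MazurkiewiczSpace → Set X := fun c =>
    connectedComponentIn (ball x₀ r ∩ Ω.carrier) c.1
  have hD : ∀ c, D c ⊆ ball x₀ r ∩ Ω.carrier := fun c => connectedComponentIn_subset _ _
  -- A point of `Ω` in the half ball is joined to a net point by a connected set of diameter less
  -- than `r / 2`, which stays in `ball x₀ r`. So adding the half ball makes `G` a neighbourhood of
  -- `x₀` without enlarging `G ∩ Ω`.
  refine ⟨ball x₀ (r / 2) ∪ ⋃₀ (D '' t), ?_, Or.inl (mem_ball_self (half_pos hr)), ?_, ?_⟩
  · refine isOpen_ball.union (isOpen_sUnion ?_)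
    rintro _ ⟨c, -, rfl⟩
    exact (isOpen_ball.inter Ω.isOpen).connectedComponentIn
  · refine union_subset (ball_subset_ball (by linarith)) (sUnion_subset ?_)
    rintro _ ⟨c, -, rfl⟩
    exact (hD c).trans inter_subset_left
  · have : (ball x₀ (r / 2) ∪ ⋃₀ (D '' t)) ∩ Ω.carrier = ⋃₀ (D '' t) := by
      refine Subset.antisymm ?_ (subset_inter subset_union_right (sUnion_subset ?_))
      · rintro x ⟨hx | hx, hxΩ⟩
        · obtain ⟨c, hct, hc⟩ := mem_iUnion₂.1
            (hcov (mem_univ (⟨x, hxΩ⟩ : Ω.MazurkiewiczSpace)))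
          obtain ⟨E, hE, hEΩ, hxE, hcE, hdiam⟩ := Ω.exists_isConnected_of_dist_lt (mem_ball.1 hc)
          refine ⟨D c, mem_image_of_mem D hct,
            hE.isPreconnected.subset_connectedComponentIn hcE ?_ hxE⟩
          refine fun z hz => ⟨?_, hEΩ hz⟩
          have := dist_le_diam_of_mem (Ω.isBounded.subset hEΩ) hz hxE
          have := mem_ball.1 hx
          have := dist_triangle z x x₀
          exact mem_ball.2 (by linarith)
        · exact hx
      · rintro _ ⟨c, -, rfl⟩
        exact (hD c).trans inter_subset_right
    rw [this]
    refine finite_componentsOf_sUnion (ht.image D) ?_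
    rintro _ ⟨c, -, rfl⟩
    exact isPreconnected_connectedComponentIn

/-- Compactness induction on the closure: local connectedness of `X` handles interior points, finite
connectedness the boundary points. -/
theorem totallyBounded_of_finitelyConnectedAt [ProperSpace X] [LocallyConnectedSpace X]
    (Ω : BoundedDomain X) (h : ∀ x₀ ∈ frontier Ω.carrier, FinitelyConnectedAt Ω.carrier x₀) :
    TotallyBounded (univ : Set Ω.MazurkiewiczSpace) := by
  refine Metric.totallyBounded_iff.2 fun ε hε => ?_
  have key : ∃ F : Set (Set X), F.Finite ∧ (∀ A ∈ F, IsPreconnected A ∧ A ⊆ Ω.carrier ∧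
      diam A < ε) ∧ closure Ω.carrier ∩ Ω.carrier ⊆ ⋃₀ F := by
    refine Ω.isBounded.isCompact_closure.induction_on (p := fun s => ∃ F : Set (Set X), F.Finite ∧
      (∀ A ∈ F, IsPreconnected A ∧ A ⊆ Ω.carrier ∧ diam A < ε) ∧ s ∩ Ω.carrier ⊆ ⋃₀ F)
      ⟨∅, finite_empty, by simp, by simp⟩ ?_ ?_ ?_
    · rintro s t hst ⟨F, h1, h2, h3⟩
      exact ⟨F, h1, h2, (inter_subset_inter_left _ hst).trans h3⟩
    · rintro s t ⟨F, h1, h2, h3⟩ ⟨F', h1', h2', h3'⟩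
      refine ⟨F ∪ F', h1.union h1', fun A hA => hA.elim (h2 A) (h2' A), ?_⟩
      rw [union_inter_distrib_right, sUnion_union]
      exact union_subset_union h3 h3'
    · intro x hx
      have hsmall : ∀ A ⊆ ball x (ε / 4), diam A < ε := fun A hA => by
        refine (diam_mono hA isBounded_ball).trans_lt
          ((diam_ball (by positivity)).trans_lt (by linarith))
      by_cases hxΩ : x ∈ Ω.carrier
      · obtain ⟨N, hN, hNo, hxN, hNc⟩ := locallyConnectedSpace_iff_subsets_isOpen_isConnected.1 ‹_›
          x (Ω.carrier ∩ ball x (ε / 4))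
          (inter_mem (Ω.isOpen.mem_nhds hxΩ) (ball_mem_nhds x (by positivity)))
        refine ⟨N, mem_nhdsWithin_of_mem_nhds (hNo.mem_nhds hxN), {N}, finite_singleton N, ?_, ?_⟩
        · rintro A rfl
          exact ⟨hNc.isPreconnected, hN.trans inter_subset_left,
            hsmall _ (hN.trans inter_subset_right)⟩
        · simp
      · obtain ⟨G, hG, hxG, hGr, hfin⟩ := h x ⟨hx, by rwa [Ω.isOpen.interior_eq]⟩ (ε / 4)
          (by positivity)
        refine ⟨G, mem_nhdsWithin_of_mem_nhds (hG.mem_nhds hxG), _, hfin, ?_, fun y hy =>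
          ⟨_, connectedComponentIn_mem_componentsOf hy, mem_connectedComponentIn hy⟩⟩
        rintro _ ⟨y, -, rfl⟩
        have hsub := connectedComponentIn_subset (G ∩ Ω.carrier) y
        exact ⟨isPreconnected_connectedComponentIn, hsub.trans inter_subset_right,
          hsmall _ ((hsub.trans inter_subset_left).trans hGr)⟩
  obtain ⟨F, hF, hFA, hcov⟩ := key
  have hne : Nonempty Ω.MazurkiewiczSpace := Ω.isConnected.nonempty.to_subtype
  -- A representative is assigned to every set, with an arbitrary value when `A` misses `Ω`.
  have : ∀ A : Set X, ∃ c : Ω.MazurkiewiczSpace, (A ∩ Ω.carrier).Nonempty → c.1 ∈ A := by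
    intro A
    by_cases hA : (A ∩ Ω.carrier).Nonempty
    · exact ⟨⟨hA.some, hA.some_mem.2⟩, fun _ => hA.some_mem.1⟩
    · exact ⟨hne.some, fun h => absurd h hA⟩
  choose c hc using this
  refine ⟨c '' F, hF.image c, fun x _ => ?_⟩
  obtain ⟨A, hA, hxA⟩ := hcov ⟨subset_closure x.2, x.2⟩
  refine mem_iUnion₂.2 ⟨c A, mem_image_of_mem c hA, mem_ball.2 ?_⟩
  exact (Ω.dist_le_diam (hFA A hA).1 (hFA A hA).2.1 x (c A) hxA (hc A ⟨x.1, hxA, x.2⟩)).trans_lt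
    (hFA A hA).2.2

end BoundedDomain

/-! ### Connectedness im kleinen -/

/-- `S` is connected im kleinen at `x`. -/
def ConnectedImKleinenAt (S : Set X) (x : X) : Prop :=
  ∀ ε > 0, ∀ᶠ y in 𝓝 x, y ∈ S → ∃ C ⊆ S ∩ ball x ε, IsPreconnected C ∧ x ∈ C ∧ y ∈ C

/-- The union of all small connected sets through `x` is a connected neighbourhood, not necessarily
open. Assuming this at every point is enough, and it is easier to verify in the examples than open
neighbourhoods. -/
theorem locallyConnectedSpace_of_connectedImKleinenAt {S : Set X}
    (h : ∀ x ∈ S, ConnectedImKleinenAt S x) : LocallyConnectedSpace S := by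
  refine locallyConnectedSpace_iff_connected_subsets.2 fun x U hU => ?_
  obtain ⟨ε, hε, hb⟩ := Metric.mem_nhds_iff.1 hU
  refine ⟨⋃₀ {C | C ⊆ ball x ε ∧ IsPreconnected C ∧ x ∈ C}, ?_,
    isPreconnected_sUnion x _ (fun C hC => hC.2.2) fun C hC => hC.2.1,
    sUnion_subset fun C hC => hC.1.trans hb⟩
  filter_upwards [continuous_subtype_val.continuousAt.eventually (h x x.2 ε hε)] with y hy
  obtain ⟨C, hC, hCp, hxC, hyC⟩ := hy y.2
  refine ⟨Subtype.val ⁻¹' C, ⟨fun z hz => (hC hz).2, ?_, hxC⟩, hyC⟩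
  rwa [← IsInducing.subtypeVal.isPreconnected_image, Subtype.image_preimage_coe,
    inter_eq_right.2 (hC.trans inter_subset_left)]

theorem connectedImKleinenAt_of_locallyConnectedSpace {S : Set X} [LocallyConnectedSpace S] {x : X}
    (hx : x ∈ S) : ConnectedImKleinenAt S x := by
  intro ε hε
  obtain ⟨V, hV, hVo, hxV, hVc⟩ := locallyConnectedSpace_iff_subsets_isOpen_isConnected.1 ‹_›
    (⟨x, hx⟩ : S) (ball ⟨x, hx⟩ ε) (ball_mem_nhds _ hε)
  obtain ⟨O, hO, rfl⟩ := isOpen_induced_iff.1 hVo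
  filter_upwards [hO.mem_nhds hxV] with y hyO hyS
  refine ⟨Subtype.val '' (Subtype.val ⁻¹' O : Set S), ?_,
    hVc.isPreconnected.image _ continuous_subtype_val.continuousOn, ⟨⟨x, hx⟩, hxV, rfl⟩,
    ⟨⟨y, hyS⟩, hyO, rfl⟩⟩
  rintro _ ⟨z, hz, rfl⟩
  exact ⟨z.2, hV hz⟩

theorem connectedImKleinenAt_of_mem_interior [LocallyConnectedSpace X] {S : Set X} {x : X}
    (hx : x ∈ interior S) : ConnectedImKleinenAt S x := by
  intro ε hε
  obtain ⟨N, hN, hNo, hxN, hNc⟩ := locallyConnectedSpace_iff_subsets_isOpen_isConnected.1 ‹_› x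
    (S ∩ ball x ε) (inter_mem (mem_interior_iff_mem_nhds.1 hx) (ball_mem_nhds x hε))
  filter_upwards [hNo.mem_nhds hxN] with y hy _
  exact ⟨N, hN, hNc.isPreconnected, hxN, hy⟩

theorem IsClosed.locallyConnectedSpace_of_frontier [LocallyConnectedSpace X] {S : Set X}
    (hS : IsClosed S) [LocallyConnectedSpace ↥(frontier S)] : LocallyConnectedSpace S := by
  refine locallyConnectedSpace_of_connectedImKleinenAt fun x hxS => ?_
  by_cases hxi : x ∈ interior S
  · exact connectedImKleinenAt_of_mem_interior hxi
  have hxF : x ∈ frontier S := ⟨subset_closure hxS, hxi⟩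
  intro ε hε
  obtain ⟨δ, hδ, hb⟩ := Metric.eventually_nhds_iff_ball.1
    (connectedImKleinenAt_of_locallyConnectedSpace hxF ε hε)
  have hFS : frontier S ∩ ball x ε ⊆ S ∩ ball x ε := inter_subset_inter_left _ hS.frontier_subset
  obtain ⟨W, hW, hWo, hxW, hWc⟩ := locallyConnectedSpace_iff_subsets_isOpen_isConnected.1 ‹_› x
    (ball x (min δ ε)) (ball_mem_nhds x (lt_min hδ hε))
  filter_upwards [hWo.mem_nhds hxW] with y hyW hyS
  by_cases hyi : y ∈ interior S
  swap
  · obtain ⟨C, hC, h⟩ := hb y (ball_subset_ball (min_le_left _ _) (hW hyW))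
      ⟨subset_closure hyS, hyi⟩
    exact ⟨C, hC.trans hFS, h⟩
  let D := connectedComponentIn (W ∩ interior S) y
  have hyD : y ∈ D := mem_connectedComponentIn ⟨hyW, hyi⟩
  have hDsub : D ⊆ W ∩ interior S := connectedComponentIn_subset _ _
  have hDo : IsOpen D := (hWo.inter isOpen_interior).connectedComponentIn
  -- Otherwise `D` would be relatively clopen in the connected set `W`, hence contain `W` and thus
  -- `x`, which is not interior to `S`.
  obtain ⟨w, hwW, hwD, hwi⟩ : ∃ w ∈ W, w ∈ closure D ∧ w ∉ interior S := by
    by_contra! hcon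
    have : W ⊆ D := hWc.isPreconnected.subset_of_closure_inter_subset hDo ⟨y, hyW, hyD⟩ ?_
    · exact hxi (hDsub (this hxW)).2
    · rintro w ⟨hwD, hwW⟩
      have hwI := hcon w hwW hwD
      obtain ⟨z, hz, hzD⟩ := mem_closure_iff.1 hwD _
        (hWo.inter isOpen_interior).connectedComponentIn (mem_connectedComponentIn ⟨hwW, hwI⟩)
      rw [show D = _ from connectedComponentIn_eq hzD, ← connectedComponentIn_eq hz]
      exact mem_connectedComponentIn ⟨hwW, hwI⟩
  have hwS : w ∈ S := hS.closure_subset_iff.2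
    (fun z hz => interior_subset (hDsub hz).2) hwD
  obtain ⟨C, hC, hCp, hxC, hwC⟩ := hb w (ball_subset_ball (min_le_left _ _) (hW hwW))
    ⟨subset_closure hwS, hwi⟩
  refine ⟨C ∪ insert w D, union_subset (hC.trans hFS) (insert_subset (hFS (hC hwC)) fun z hz =>
    ⟨interior_subset (hDsub hz).2, ball_subset_ball (min_le_right _ _) (hW (hDsub hz).1)⟩),
    hCp.union w hwC (mem_insert w D) ?_, Or.inl hxC, Or.inr (Or.inr hyD)⟩
  exact isPreconnected_connectedComponentIn.subset_closure (subset_insert w D)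
    (insert_subset hwD subset_closure)

/-! ### Summary of the implications -/

namespace BoundaryCondition

theorem e_iff_d [ProperSpace X] [LocallyConnectedSpace X] (Ω : BoundedDomain X) :
    e.Holds Ω ↔ d.Holds Ω :=
  Ω.compactSpace_mazurkiewiczClosure_iff.trans
    ⟨fun h x₀ _ => Ω.finitelyConnectedAt_of_totallyBounded h x₀,
      Ω.totallyBounded_of_finitelyConnectedAt⟩

theorem c_of_d (Ω : BoundedDomain X) (h : d.Holds Ω) : c.Holds Ω :=
  fun _ hr x₀ hx₀ => notMem_closure_remainder_of_finitelyConnectedAt (h x₀ hx₀) hr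

theorem b_of_c [LocallyConnectedSpace X] (Ω : BoundedDomain X) (h : c.Holds Ω) : b.Holds Ω :=
  fun x₀ hx₀ => locallyConnectedAt_insert_of_notMem_closure_remainder Ω.isOpen
    fun r hr => h r hr x₀ hx₀

theorem a_of_b [ProperSpace X] [LocallyConnectedSpace X] (Ω : BoundedDomain X) (h : b.Holds Ω) :
    a.Holds Ω := fun x₀ hx₀ =>
  locallyAccessible_of_locallyConnectedAt_insert Ω.isOpen
    (by rw [Ω.isOpen.frontier_eq] at hx₀; exact hx₀.2) (h x₀ hx₀)

theorem c_of_a (Ω : BoundedDomain X) (h : a.Holds Ω) : c.Holds Ω :=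
  fun _ hr x₀ hx₀ => notMem_closure_remainder_of_locallyAccessible (h x₀ hx₀) hr

theorem g_of_f [LocallyConnectedSpace X] (Ω : BoundedDomain X) (h : f.Holds Ω) : g.Holds Ω := by
  have : LocallyConnectedSpace ↥(frontier Ω.carrierᶜ) := by rwa [frontier_compl]
  exact Ω.isOpen.isClosed_compl.locallyConnectedSpace_of_frontier

theorem Arrow.imp [ProperSpace X] [LocallyConnectedSpace X] {i j : BoundaryCondition}
    (hij : Relation.ReflTransGen Arrow i j) (Ω : BoundedDomain X) (h : i.Holds Ω) :
    j.Holds Ω := by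
  induction hij with
  | refl => exact h
  | tail _ hjk ih =>
    cases hjk with
    | ed => exact (e_iff_d Ω).1 ih
    | de => exact (e_iff_d Ω).2 ih
    | dc => exact c_of_d Ω ih
    | cb => exact b_of_c Ω ih
    | bc => exact c_of_a Ω (a_of_b Ω ih)
    | ba => exact a_of_b Ω ih
    | ab => exact b_of_c Ω (c_of_a Ω ih)
    | fg => exact g_of_f Ω ih

end BoundaryCondition

end Implications

/-! ### Boxes with chimneys -/

/-- Euclidean three-space. -/
abbrev Space3 : Type := EuclideanSpace ℝ (Fin 3)

namespace Space3

theorem ext {v w : Space3} (h0 : v 0 = w 0) (h1 : v 1 = w 1) (h2 : v 2 = w 2) : v = w := by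
  ext i
  fin_cases i
  exacts [h0, h1, h2]

@[fun_prop]
theorem continuousOn_mk {α : Type*} [TopologicalSpace α] {s : Set α} {f g h : α → ℝ}
    (hf : ContinuousOn f s) (hg : ContinuousOn g s) (hh : ContinuousOn h s) :
    ContinuousOn (fun a => (!₂[f a, g a, h a] : Space3)) s := by
  refine (PiLp.continuous_toLp 2 _).comp_continuousOn (continuousOn_pi.2 fun i => ?_)
  fin_cases i
  exacts [hf, hg, hh]

@[fun_prop]
theorem continuous_mk {α : Type*} [TopologicalSpace α] {f g h : α → ℝ}
    (hf : Continuous f) (hg : Continuous g) (hh : Continuous h) :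
    Continuous (fun a => (!₂[f a, g a, h a] : Space3)) :=
  continuousOn_univ.1 (continuousOn_mk hf.continuousOn hg.continuousOn hh.continuousOn)

theorem norm_sq (v : Space3) : ‖v‖ ^ 2 = v 0 ^ 2 + v 1 ^ 2 + v 2 ^ 2 := by
  rw [EuclideanSpace.norm_sq_eq, Fin.sum_univ_three]
  simp

theorem abs_sub_le_dist (v w : Space3) (i : Fin 3) : |v i - w i| ≤ dist v w := by
  rw [dist_eq_norm]
  exact PiLp.norm_apply_le (v - w) i

theorem dist_le_dist {v w x : Space3} (h0 : |v 0 - x 0| ≤ |w 0 - x 0|)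
    (h1 : |v 1 - x 1| ≤ |w 1 - x 1|) (h2 : |v 2 - x 2| ≤ |w 2 - x 2|) : dist v x ≤ dist w x := by
  rw [dist_eq_norm, dist_eq_norm, ← abs_of_nonneg (norm_nonneg (v - x)),
    ← abs_of_nonneg (norm_nonneg (w - x)), ← sq_le_sq, norm_sq, norm_sq]
  exact add_le_add (add_le_add (sq_le_sq.2 h0) (sq_le_sq.2 h1)) (sq_le_sq.2 h2)

end Space3

/-- The box `U × (-1, 0)` together with a chimney of height `1` above `W`. -/
def chimney (U W : Set (ℝ × ℝ)) : Set Space3 :=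
  {v | (v 0, v 1) ∈ U ∧ -1 < v 2 ∧ v 2 < 1 ∧ (v 2 < 0 ∨ (v 0, v 1) ∈ W)}

section Chimney

variable {U W : Set (ℝ × ℝ)}

theorem mem_chimney {v : Space3} :
    v ∈ chimney U W ↔ (v 0, v 1) ∈ U ∧ -1 < v 2 ∧ v 2 < 1 ∧ (v 2 < 0 ∨ (v 0, v 1) ∈ W) :=
  Iff.rfl

theorem isOpen_chimney (hU : IsOpen U) (hW : IsOpen W) : IsOpen (chimney U W) := by
  have hp : Continuous fun v : Space3 => (v 0, v 1) := by fun_prop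
  have h2 : Continuous fun v : Space3 => v 2 := by fun_prop
  exact (hU.preimage hp).inter ((isOpen_lt continuous_const h2).inter
    ((isOpen_lt h2 continuous_const).inter ((isOpen_lt h2 continuous_const).union
      (hW.preimage hp))))

theorem convex_chimney_empty (hU : Convex ℝ U) : Convex ℝ (chimney U ∅) := by
  rintro v ⟨hv, hv1, -, hv0 | h⟩ w ⟨hw, hw1, -, hw0 | h⟩ s t hs ht hst
  · have h := hU hv hw hs ht hst
    have h2 : (s • v + t • w) 2 = s * v 2 + t * w 2 := rfl
    refine ⟨h, ?_, ?_, Or.inl ?_⟩ <;> rw [h2] <;>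
      rcases hs.eq_or_lt with rfl | hs <;> nlinarith
  all_goals exact absurd h (notMem_empty _)

theorem isBounded_chimney (hU : Bornology.IsBounded U) : Bornology.IsBounded (chimney U W) := by
  obtain ⟨R, hR⟩ := isBounded_iff_forall_norm_le.1 hU
  refine isBounded_iff_forall_norm_le.2 ⟨2 * |R| + 1, fun v hv => ?_⟩
  have h := hR _ hv.1
  have h0 : |v 0| ≤ |R| := (norm_fst_le _).trans (h.trans (le_abs_self R))
  have h1 : |v 1| ≤ |R| := (norm_snd_le _).trans (h.trans (le_abs_self R))
  have h2 : |v 2| ≤ 1 := abs_le.2 ⟨hv.2.1.le, hv.2.2.1.le⟩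
  refine abs_le_of_sq_le_sq' ?_ (by positivity) |>.2
  rw [Space3.norm_sq, ← sq_abs (v 0), ← sq_abs (v 1), ← sq_abs (v 2)]
  nlinarith [abs_nonneg (v 0), abs_nonneg (v 1), abs_nonneg (v 2)]

/-- A box with a chimney is homeomorphic to the box. -/
theorem nonempty_homeomorph_chimney_empty (hW : IsOpen W) (hW' : Wᶜ.Nonempty) :
    Nonempty (chimney U W ≃ₜ chimney U ∅) := by
  -- The distance to the complement of `W` will be the flattened chimney height, vanishing off `W`.
  obtain ⟨k, hk, hk0, hkW⟩ : ∃ k : ℝ × ℝ → ℝ, Continuous k ∧ (∀ p, 0 ≤ k p) ∧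
      ∀ p, p ∈ W ↔ 0 < k p :=
    ⟨fun p => infDist p Wᶜ, continuous_infDist_pt _, fun p => infDist_nonneg, fun p => by
      rw [← hW.isClosed_compl.notMem_iff_infDist_pos hW', notMem_compl_iff]⟩
  let κ : Space3 → ℝ := fun v => k (v 0, v 1)
  have hκ : Continuous κ := by fun_prop
  have hκ1 : ∀ v, κ v + 1 ≠ 0 := fun v => (by linarith [hk0 (v 0, v 1)] : 0 < κ v + 1).ne'
  -- On each fibre, positive heights are scaled by `κ`, giving the interval from `-1` to `κ`, which
  -- is then mapped affinely onto `(-1, 0)`. The inverse first undoes the affine map by `ω`, then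
  -- divides the positive part by `κ`.
  let up : Space3 → Space3 := fun v =>
    !₂[v 0, v 1, (min (v 2) 0 + max (v 2) 0 * κ v + 1) / (κ v + 1) - 1]
  let ω : Space3 → ℝ := fun v => (v 2 + 1) * (κ v + 1) - 1
  let down : Space3 → Space3 := fun v => !₂[v 0, v 1, min (ω v) 0 + max (ω v) 0 / κ v]
  have hω : Continuous ω := by fun_prop
  have hup : Continuous up := by
    refine Space3.continuous_mk (by fun_prop) (by fun_prop) ?_
    exact (Continuous.div (by fun_prop) (by fun_prop) hκ1).sub continuous_const
  have hωlt : ∀ v ∈ chimney U ∅, -1 < ω v ∧ ω v < κ v := by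
    rintro v ⟨-, h1, -, h0 | h⟩
    · have := hk0 (v 0, v 1)
      constructor <;> simp only [ω, κ] <;> nlinarith
    · exact absurd h (notMem_empty _)
  have hdown : ContinuousOn down (chimney U ∅) := by
    refine Space3.continuousOn_mk (by fun_prop) (by fun_prop) fun v hv => ?_
    refine ContinuousAt.continuousWithinAt ?_
    -- Where `κ v = 0` one has `ω v < 0`, so the term divided by `κ` vanishes in a whole
    -- neighbourhood.
    rcases (hk0 (v 0, v 1)).eq_or_lt with h | h
    · have hneg : ω v < 0 := (hωlt v hv).2.trans_eq h.symm
      refine hω.continuousAt.congr ?_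
      filter_upwards [hω.continuousAt.eventually (gt_mem_nhds hneg)] with w hw
      rw [min_eq_left hw.le, max_eq_right hw.le, zero_div, add_zero]
    · exact (hω.min continuous_const).continuousAt.add
        ((hω.max continuous_const).continuousAt.div hκ.continuousAt h.ne')
  have hmem_up : ∀ v ∈ chimney U W, up v ∈ chimney U ∅ := by
    rintro v ⟨hU, h1, h2, h3⟩
    have hk := hk0 (v 0, v 1)
    have hs : -1 < min (v 2) 0 + max (v 2) 0 * κ v ∧
        min (v 2) 0 + max (v 2) 0 * κ v < κ v := by
      rcases lt_or_ge (v 2) 0 with h0 | h0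
      · rw [min_eq_left h0.le, max_eq_right h0.le]
        constructor <;> simp only [κ] <;> linarith
      · have hkp := (hkW _).1 (h3.resolve_left h0.not_gt)
        rw [min_eq_right h0, max_eq_left h0]
        constructor <;> simp only [κ] <;> nlinarith
    have hk1 : 0 < κ v + 1 := by simp only [κ]; linarith
    have h4 : 0 < (min (v 2) 0 + max (v 2) 0 * κ v + 1) / (κ v + 1) :=
      div_pos (by linarith) hk1
    have h5 : (min (v 2) 0 + max (v 2) 0 * κ v + 1) / (κ v + 1) < 1 := by
      rw [div_lt_one hk1]
      linarith
    refine ⟨hU, ?_, ?_, Or.inl ?_⟩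
    · change -1 < _ - 1
      linarith
    · change _ - 1 < (1 : ℝ)
      linarith
    · change _ - 1 < (0 : ℝ)
      linarith
  have hmem_down : ∀ v ∈ chimney U ∅, down v ∈ chimney U W := by
    intro v hv
    have h := hωlt v hv
    rcases lt_or_ge (ω v) 0 with h0 | h0
    · have : down v = !₂[v 0, v 1, ω v] := by
        simp only [down]
        rw [min_eq_left h0.le, max_eq_right h0.le, zero_div, add_zero]
      rw [this]
      exact ⟨hv.1, h.1, h0.trans zero_lt_one, Or.inl h0⟩
    · have hkp : 0 < κ v := h0.trans_lt h.2
      have : down v = !₂[v 0, v 1, ω v / κ v] := by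
        simp only [down]
        rw [min_eq_right h0, max_eq_left h0, zero_add]
      rw [this]
      refine ⟨hv.1, neg_one_lt_zero.trans_le (div_nonneg h0 hkp.le), (div_lt_one hkp).2 h.2,
        Or.inr ((hkW _).2 hkp)⟩
  refine ⟨⟨⟨fun v => ⟨up v, hmem_up v v.2⟩, fun v => ⟨down v, hmem_down v v.2⟩, ?_, ?_⟩,
    (hup.comp continuous_subtype_val).subtype_mk _,
    (continuousOn_iff_continuous_domRestrict.1 hdown).subtype_mk _⟩⟩
  · rintro ⟨v, hv⟩
    refine Subtype.ext (Space3.ext rfl rfl ?_)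
    have hω' : ω (up v) = min (v 2) 0 + max (v 2) 0 * κ v := by
      change ((min (v 2) 0 + max (v 2) 0 * κ v + 1) / (κ v + 1) - 1 + 1) * (κ v + 1) - 1 = _
      rw [sub_add_cancel, div_mul_cancel₀ _ (hκ1 v), add_sub_cancel_right]
    change min (ω (up v)) 0 + max (ω (up v)) 0 / κ v = v 2
    rw [hω']
    rcases lt_or_ge (v 2) 0 with h0 | h0
    · rw [min_eq_left h0.le, max_eq_right h0.le, zero_mul, add_zero, min_eq_left h0.le,
        max_eq_right h0.le, zero_div, add_zero]
    · have hkp : 0 < κ v := (hkW _).1 (hv.2.2.2.resolve_left h0.not_gt)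
      rw [min_eq_right h0, max_eq_left h0, zero_add, min_eq_right (by positivity),
        max_eq_left (by positivity), zero_add, mul_div_cancel_right₀ _ hkp.ne']
  · rintro ⟨v, hv⟩
    refine Subtype.ext (Space3.ext rfl rfl ?_)
    have h := hωlt v hv
    have key : min (down v 2) 0 + max (down v 2) 0 * κ v = ω v := by
      change min (min (ω v) 0 + max (ω v) 0 / κ v) 0 +
        max (min (ω v) 0 + max (ω v) 0 / κ v) 0 * κ v = ω v
      rcases lt_or_ge (ω v) 0 with h0 | h0
      · rw [min_eq_left h0.le, max_eq_right h0.le, zero_div, add_zero, min_eq_left h0.le,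
          max_eq_right h0.le, zero_mul, add_zero]
      · have hkp : 0 < κ v := h0.trans_lt h.2
        rw [min_eq_right h0, max_eq_left h0, zero_add, min_eq_right (by positivity),
          max_eq_left (by positivity), zero_add, div_mul_cancel₀ _ hkp.ne']
    change (min (down v 2) 0 + max (down v 2) 0 * κ v + 1) / (κ v + 1) - 1 = v 2
    rw [key]
    simp only [ω]
    rw [sub_add_cancel, mul_div_cancel_right₀ _ (hκ1 v), add_sub_cancel_right]

theorem nonempty_homeomorph_ball (hU : IsOpen U) (hUc : Convex ℝ U) (hUb : Bornology.IsBounded U)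
    (hUn : U.Nonempty) (hW : IsOpen W) (hW' : Wᶜ.Nonempty) :
    Nonempty (chimney U W ≃ₜ ball (0 : Space3) 1) := by
  obtain ⟨φ⟩ := nonempty_homeomorph_chimney_empty (U := U) hW hW'
  have hopen := isOpen_chimney hU isOpen_empty
  obtain ⟨p, hp⟩ := hUn
  have hne : (!₂[p.1, p.2, -1 / 2] : Space3) ∈ chimney U ∅ := by
    refine ⟨hp, ?_, ?_, Or.inl ?_⟩ <;> simp <;> norm_num
  obtain ⟨h, hh, -⟩ := exists_homeomorph_image_interior_closure_frontier_eq_unitBall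
    (convex_chimney_empty hUc) (by rw [hopen.interior_eq]; exact ⟨_, hne⟩)
    (isBounded_chimney hUb)
  rw [hopen.interior_eq] at hh
  exact ⟨φ.trans ((h.image _).trans (Homeomorph.setCongr hh))⟩

/-- A box with a chimney as a bounded domain. -/
def chimneyDomain (U W : Set (ℝ × ℝ)) (hU : IsOpen U) (hUc : Convex ℝ U)
    (hUb : Bornology.IsBounded U) (hUn : U.Nonempty) (hW : IsOpen W) (hW' : Wᶜ.Nonempty) :
    BoundedDomain Space3 where
  carrier := chimney U W
  isOpen := isOpen_chimney hU hW
  isConnected := by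
    obtain ⟨φ⟩ := nonempty_homeomorph_ball hU hUc hUb hUn hW hW'
    have : ConnectedSpace (ball (0 : Space3) 1) := isConnected_iff_connectedSpace.1
      ((convex_ball 0 1).isConnected ⟨0, mem_ball_self one_pos⟩)
    have := φ.symm.surjective.connectedSpace φ.symm.continuous
    exact isConnected_iff_connectedSpace.2 this
  isBounded := isBounded_chimney hUb

end Chimney

/-! ### Full columns and the common accumulation point -/

section Chimney

variable {U W P : Set (ℝ × ℝ)}

/-- Taking both sets equal gives the full column `P × (-1, 1)`; such columns are the convex pieces
of the examples. -/
theorem convex_chimney_self (hP : Convex ℝ P) : Convex ℝ (chimney P P) := by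
  rintro v ⟨hv, hv1, hv2, -⟩ w ⟨hw, hw1, hw2, -⟩ s t hs ht hst
  have h := hP hv hw hs ht hst
  have h2 : (s • v + t • w) 2 = s * v 2 + t * w 2 := rfl
  refine ⟨h, ?_, ?_, Or.inr h⟩ <;> rw [h2] <;> rcases hs.eq_or_lt with rfl | hs <;> nlinarith

theorem chimney_self_subset (hU : P ⊆ U) (hW : P ⊆ W) : chimney P P ⊆ chimney U W :=
  fun _ hv => ⟨hU hv.1, hv.2.1, hv.2.2.1, Or.inr (hW hv.1)⟩

theorem closure_chimney_subset : closure (chimney U W) ⊆ {v | -1 ≤ v 2 ∧ v 2 ≤ 1} := by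
  have h2 : Continuous fun v : Space3 => v 2 := by fun_prop
  exact closure_minimal (fun v hv => ⟨hv.2.1.le, hv.2.2.1.le⟩)
    ((isClosed_le continuous_const h2).inter (isClosed_le h2 continuous_const))

theorem mem_frontier_chimneyDomain {Ω : BoundedDomain Space3} {v : Space3} :
    v ∈ frontier Ω.carrier ↔ v ∈ closure Ω.carrier ∧ v ∉ Ω.carrier := by
  rw [Ω.isOpen.frontier_eq, Set.mem_sdiff]

/-- The open square `(-1, 1) × (-1, 1)`. -/
def openSquare : Set (ℝ × ℝ) := Ioo (-1) 1 ×ˢ Ioo (-1) 1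

theorem isOpen_openSquare : IsOpen openSquare := isOpen_Ioo.prod isOpen_Ioo

theorem convex_openSquare : Convex ℝ openSquare := (convex_Ioo _ _).prod (convex_Ioo _ _)

theorem isBounded_openSquare : Bornology.IsBounded openSquare :=
  (isBounded_Ioo _ _).prod (isBounded_Ioo _ _)

theorem zero_mem_openSquare : ((0 : ℝ), (0 : ℝ)) ∈ openSquare := by
  simp [openSquare]

/-- The point `(0, 0, 1/2)` around which the chimneys of all examples accumulate. -/
noncomputable def midPoint : Space3 := !₂[0, 0, 1 / 2]

@[simp] theorem midPoint_zero : midPoint 0 = 0 := rfl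
@[simp] theorem midPoint_one : midPoint 1 = 0 := rfl
@[simp] theorem midPoint_two : midPoint 2 = 1 / 2 := rfl

theorem dist_midPoint {x : ℝ} (hx : 0 < x) : dist (!₂[x, 0, 1 / 2] : Space3) midPoint = x := by
  rw [dist_eq_norm, ← abs_of_nonneg (norm_nonneg _), ← abs_of_pos hx, ← sq_eq_sq_iff_abs_eq_abs,
    Space3.norm_sq]
  simp

/-- Radius `1 / 2` confines the ball to positive heights, where only chimneys are present. -/
theorem abs_lt_of_mem_ball_midPoint {v : Space3} (hv : v ∈ ball midPoint (1 / 2)) :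
    |v 0| < 1 / 2 ∧ |v 1| < 1 / 2 ∧ 0 < v 2 ∧ v 2 < 1 := by
  have h := fun i => (Space3.abs_sub_le_dist v midPoint i).trans_lt (mem_ball.1 hv)
  have h2 := abs_lt.1 (h 2)
  refine ⟨by simpa using h 0, by simpa using h 1, ?_, ?_⟩ <;> simp at h2 <;> linarith

theorem midPoint_mem_chimney : midPoint ∈ chimney U W ↔ (0, 0) ∈ U ∧ (0, 0) ∈ W := by
  rw [mem_chimney]
  simp only [midPoint_zero, midPoint_one, midPoint_two]
  norm_num

end Chimney

theorem IsPreconnected.exists_coord_eq {C : Set Space3} (hC : IsPreconnected C) {v w : Space3}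
    (hv : v ∈ C) (hw : w ∈ C) (i : Fin 3) {t : ℝ} (h1 : v i ≤ t) (h2 : t ≤ w i) :
    ∃ u ∈ C, u i = t :=
  (hC.image (fun u : Space3 => u i) (by fun_prop)).Icc_subset (mem_image_of_mem _ hv)
    (mem_image_of_mem _ hw) ⟨h1, h2⟩

/-! ### The oscillating function `sin (1 / x)` -/

/-- The factor `x` restores continuity at `0` without changing the positive zeros, so planar sets
defined by strict inequalities in this function are open. -/
theorem continuous_mul_sin_inv : Continuous fun x : ℝ => x * Real.sin x⁻¹ := by
  refine continuous_iff_continuousAt.2 fun x => ?_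
  rcases eq_or_ne x 0 with rfl | hx
  · rw [ContinuousAt, zero_mul]
    have h0 : Tendsto (fun x : ℝ => |x|) (𝓝 0) (𝓝 0) := by
      simpa using continuous_abs.tendsto (0 : ℝ)
    refine squeeze_zero_norm (fun x => ?_) h0
    rw [Real.norm_eq_abs, abs_mul]
    exact mul_le_of_le_one_right (abs_nonneg x) (Real.abs_sin_le_one _)
  · exact continuousAt_id.mul (Real.continuous_sin.continuousAt.comp (continuousAt_inv₀ hx))

theorem exists_sin_inv_eq (c : ℝ) {ε : ℝ} (hε : 0 < ε) :
    ∃ x, 0 < x ∧ x < ε ∧ Real.sin x⁻¹ = Real.sin c := by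
  obtain ⟨n, hn⟩ := exists_nat_gt (ε⁻¹ + |c|)
  have h1 : ε⁻¹ < c + n * (2 * Real.pi) := by
    have h2 : (n : ℝ) ≤ n * (2 * Real.pi) :=
      le_mul_of_one_le_right n.cast_nonneg (by linarith [Real.pi_gt_three])
    linarith [neg_abs_le c]
  have h3 : 0 < c + n * (2 * Real.pi) := (inv_pos.2 hε).trans h1
  exact ⟨(c + n * (2 * Real.pi))⁻¹, inv_pos.2 h3, inv_lt_of_inv_lt₀ hε h1, by
    rw [inv_inv, Real.sin_add_nat_mul_two_pi]⟩

theorem eventually_abs_inv_sub_inv_lt_pi {x : ℝ} (hx : x ≠ 0) :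
    ∀ᶠ y in 𝓝 x, |y⁻¹ - x⁻¹| < Real.pi :=
  (((continuousAt_inv₀ hx).sub continuousAt_const).abs.eventually
    (gt_mem_nhds (by simpa using Real.pi_pos)))

/-- Reciprocals of distinct zeros differ by at least `π`, so the zeros are isolated away from `0`.
-/
theorem eq_of_sin_inv_eq_zero {x y : ℝ} (h : |y⁻¹ - x⁻¹| < Real.pi) (hx : Real.sin x⁻¹ = 0)
    (hy : Real.sin y⁻¹ = 0) : y = x := by
  have h' := abs_lt.1 h
  have := (Real.sin_eq_zero_iff_of_lt_of_lt h'.1 h'.2).1 (by rw [Real.sin_sub, hx, hy]; simp)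
  exact inv_injective (sub_eq_zero.1 this)

/-! ### Finitely connected at the boundary, but the complement is not locally connected -/

/-- The plane without a sequence of points converging to the origin. -/
def hairComplement : Set (ℝ × ℝ) := {p | p.2 ≠ 0 ∨ p.1 * Real.sin p.1⁻¹ ≠ 0}

theorem isOpen_hairComplement : IsOpen hairComplement :=
  (isOpen_ne_fun continuous_snd continuous_const).union
    (isOpen_ne_fun (continuous_mul_sin_inv.comp continuous_fst) continuous_const)

theorem zero_notMem_hairComplement : ((0 : ℝ), (0 : ℝ)) ∉ hairComplement := by
  simp [hairComplement]

/-- A cube without a sequence of vertical hairs converging to a vertical hair. -/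
def hairyDomain : BoundedDomain Space3 :=
  chimneyDomain openSquare hairComplement isOpen_openSquare convex_openSquare isBounded_openSquare
    ⟨_, zero_mem_openSquare⟩ isOpen_hairComplement ⟨_, zero_notMem_hairComplement⟩

/-- All hairs lie in the plane `v 1 = 0`. Each closed half of a ball intersected with the domain
lies between a convex set and its closure, so there are at most two components. -/
theorem hairyDomain_holds_d : BoundaryCondition.d.Holds hairyDomain := by
  intro x₀ _ r hr
  refine ⟨ball x₀ r, isOpen_ball, mem_ball_self hr, subset_rfl, ?_⟩
  let S : Set Space3 := ball x₀ r ∩ chimney openSquare hairComplement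
  have hS : IsOpen S := isOpen_ball.inter (isOpen_chimney isOpen_openSquare isOpen_hairComplement)
  let H : ℝ → Set (ℝ × ℝ) := fun s => openSquare ∩ {p | 0 < s * p.2}
  have hH : ∀ s, Convex ℝ (H s) := fun s =>
    convex_openSquare.inter (convex_halfSpace_gt ⟨fun p q => mul_add s p.2 q.2, fun c p =>
      mul_left_comm s c p.2⟩ 0)
  have key : ∀ s : ℝ, s ^ 2 = 1 → IsPreconnected (S ∩ {v | 0 ≤ s * v 1}) := by
    intro s hs
    refine ((convex_ball x₀ r).inter (convex_chimney_self (hH s))).isPreconnected.subset_closure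
      ?_ ?_
    · exact fun v hv => ⟨⟨hv.1, chimney_self_subset inter_subset_left (fun p hp => Or.inl fun h => by
        have : 0 < s * p.2 := hp.2
        simp [h] at this) hv.2⟩, (show 0 < s * v 1 from hv.2.1.2).le⟩
    · rintro v ⟨hvS, hv⟩
      have hlim : Tendsto (fun t : ℝ => (!₂[v 0, v 1 + t * s, v 2] : Space3)) (𝓝[>] 0) (𝓝 v) := by
        have : Continuous fun t : ℝ => (!₂[v 0, v 1 + t * s, v 2] : Space3) := by fun_prop
        refine ((this.tendsto 0).mono_left nhdsWithin_le_nhds).trans_eq ?_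
        congr 1
        exact Space3.ext rfl (by simp) rfl
      refine mem_closure_of_tendsto hlim ?_
      filter_upwards [hlim.eventually (hS.mem_nhds hvS), self_mem_nhdsWithin] with t ht ht0
      have hpos : 0 < s * (v 1 + t * s) := by
        have h0 : (0 : ℝ) < t := ht0
        have h1 : 0 ≤ s * v 1 := hv
        nlinarith
      exact ⟨ht.1, ⟨ht.2.1, hpos⟩, ht.2.2.1, ht.2.2.2.1, Or.inr ⟨ht.2.1, hpos⟩⟩
  have hU : S = ⋃₀ {S ∩ {v | 0 ≤ (1 : ℝ) * v 1}, S ∩ {v | 0 ≤ (-1 : ℝ) * v 1}} := by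
    rw [sUnion_pair, ← inter_union_distrib_left, eq_comm, inter_eq_left]
    intro v _
    rcases le_total 0 (v 1) with h | h
    · exact Or.inl (by simpa using h)
    · exact Or.inr (by simpa using h)
  change (componentsOf S).Finite
  rw [hU]
  refine finite_componentsOf_sUnion (by simp) ?_
  rintro A (rfl | rfl)
  · exact key 1 (by norm_num)
  · exact key (-1) (by norm_num)

/-- A small connected subset of the complement from the central hair to another hair would have to
cross a value of the first coordinate where the sine is `1`, and there no hair stands. -/
theorem hairyDomain_not_holds_g : ¬ BoundaryCondition.g.Holds hairyDomain := by
  intro hg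
  have : LocallyConnectedSpace ↥(chimney openSquare hairComplement)ᶜ := hg
  have hmid : midPoint ∈ (chimney openSquare hairComplement)ᶜ := fun h =>
    zero_notMem_hairComplement (midPoint_mem_chimney.1 h).2
  obtain ⟨δ, hδ, hb⟩ := Metric.eventually_nhds_iff_ball.1
    (connectedImKleinenAt_of_locallyConnectedSpace hmid (1 / 2) (by norm_num))
  obtain ⟨x, hx0, hxδ, hx⟩ := exists_sin_inv_eq 0 hδ
  rw [Real.sin_zero] at hx
  obtain ⟨C, hC, hCp, hmC, hxC⟩ := hb !₂[x, 0, 1 / 2] (by rwa [mem_ball, dist_midPoint hx0]) (by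
    rintro ⟨-, -, -, h | h | h⟩
    · have : (1 / 2 : ℝ) < 0 := h
      norm_num at this
    · exact h rfl
    · exact h (by simp [hx]))
  obtain ⟨y, hy0, hyx, hy⟩ := exists_sin_inv_eq (Real.pi / 2) hx0
  rw [Real.sin_pi_div_two] at hy
  obtain ⟨u, hu, rfl⟩ := hCp.exists_coord_eq hmC hxC 0 (t := y) hy0.le hyx.le
  obtain ⟨h0, h1, h2, h3⟩ := abs_lt_of_mem_ball_midPoint (hC hu).2
  refine (hC hu).1 ⟨⟨?_, ?_⟩, by linarith, h3, Or.inr (Or.inr ?_)⟩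
  · exact abs_lt.1 (h0.trans (by norm_num))
  · exact abs_lt.1 (h1.trans (by norm_num))
  · simpa [hy] using hy0.ne'

/-! ### Locally accessible, but not finitely connected at the boundary -/

/-- If near `x₀` the set `Ω` is covered by convex subsets having `x₀` in their closure, then `x₀`
is not a limit of the remainder. -/
theorem notMem_closure_remainder_of_convex {Ω : Set Space3} {x₀ : Space3} {r : ℝ} (hr : 0 < r)
    (h : ∀ᶠ x in 𝓝 x₀, x ∈ Ω → ∃ P, Convex ℝ P ∧ P ⊆ Ω ∧ x ∈ P ∧ x₀ ∈ closure P) :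
    x₀ ∉ closure (remainder Ω r x₀) := by
  rw [mem_closure_iff_frequently, not_frequently]
  filter_upwards [h, ball_mem_nhds x₀ hr] with x hx hxr hxR
  obtain ⟨P, hP, hPΩ, hxP, hx₀⟩ := hx hxR.1.2
  exact notMem_remainder_of_isPreconnected ((convex_ball x₀ r).inter hP).isPreconnected
    (inter_subset_inter_right _ hPΩ) ⟨hxr, hxP⟩
    (isOpen_ball.inter_closure ⟨mem_ball_self hr, hx₀⟩) hxR

/-- Disjoint convex sectors with vertex at the origin and diameters tending to zero. -/
def sector (n : ℕ) : Set (ℝ × ℝ) :=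
  {p | p.1 < (n + 2) * p.2 ∧ (n + 1) * p.2 < p.1 ∧ p.1 ^ 2 < p.2}

theorem isOpen_sector (n : ℕ) : IsOpen (sector n) := by
  have h1 : IsOpen {p : ℝ × ℝ | p.1 < (n + 2) * p.2} := isOpen_lt (by fun_prop) (by fun_prop)
  have h2 : IsOpen {p : ℝ × ℝ | (n + 1) * p.2 < p.1} := isOpen_lt (by fun_prop) (by fun_prop)
  have h3 : IsOpen {p : ℝ × ℝ | p.1 ^ 2 < p.2} := isOpen_lt (by fun_prop) (by fun_prop)
  exact h1.inter (h2.inter h3)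

theorem convex_sector (n : ℕ) : Convex ℝ (sector n) := by
  rintro ⟨x, y⟩ ⟨h1, h2, h3⟩ ⟨x', y'⟩ ⟨h1', h2', h3'⟩ s t hs ht hst
  simp only at h1 h2 h3 h1' h2' h3'
  obtain rfl : t = 1 - s := by linarith
  refine ⟨?_, ?_, ?_⟩ <;> simp only [Prod.smul_mk, Prod.mk_add_mk, smul_eq_mul]
  · rcases hs.eq_or_lt with rfl | hs <;> nlinarith
  · rcases hs.eq_or_lt with rfl | hs <;> nlinarith
  · have h4 : (s * x + (1 - s) * x') ^ 2 ≤ s * x ^ 2 + (1 - s) * x' ^ 2 := by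
      nlinarith [mul_nonneg (mul_nonneg hs ht) (sq_nonneg (x - x'))]
    rcases hs.eq_or_lt with rfl | hs <;> nlinarith

/-- From `(n + 1) * y < x` and `x ^ 2 < y` one gets `(n + 1) * x < 1`: the sectors shrink, so only
finitely many come near a point with positive first coordinate. -/
theorem sector_bounds {n : ℕ} {p : ℝ × ℝ} (hp : p ∈ sector n) :
    0 < p.2 ∧ p.2 < p.1 ∧ (n + 1) * p.1 < 1 ∧ p.1 < 1 := by
  obtain ⟨-, h2, h3⟩ := hp
  have hy : 0 < p.2 := (sq_nonneg _).trans_lt h3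
  have hn : (0 : ℝ) ≤ n := n.cast_nonneg
  have hyx : p.2 < p.1 := by nlinarith
  have hx : (n + 1) * p.1 < 1 := by
    by_contra! h
    nlinarith
  exact ⟨hy, hyx, hx, by nlinarith⟩

theorem sector_subset_openSquare (n : ℕ) : sector n ⊆ openSquare := fun p hp => by
  obtain ⟨h1, h2, -, h4⟩ := sector_bounds hp
  exact ⟨⟨by linarith, h4⟩, by linarith, by linarith⟩

theorem eq_of_mem_sector {m n : ℕ} {p : ℝ × ℝ} (hm : p ∈ sector m) (hn : p ∈ sector n) :
    m = n := by
  have hy := (sector_bounds hm).1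
  have h1 : (m : ℝ) + 1 < n + 2 := lt_of_mul_lt_mul_right (hm.2.1.trans hn.1) hy.le
  have h2 : (n : ℝ) + 1 < m + 2 := lt_of_mul_lt_mul_right (hn.2.1.trans hm.1) hy.le
  have h3 : m < n + 1 := by exact_mod_cast (by linarith : (m : ℝ) < n + 1)
  have h4 : n < m + 1 := by exact_mod_cast (by linarith : (n : ℝ) < m + 1)
  omega

theorem mem_closure_chimney_sector (n : ℕ) {v : Space3} (h0 : v 0 = 0) (h1 : v 1 = 0)
    (h2 : -1 ≤ v 2) (h3 : v 2 ≤ 1) : v ∈ closure (chimney (sector n) (sector n)) := by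
  -- The ratio `(2 * n + 3) / 2` lies midway between the slopes bounding the sector, and `1 - t`
  -- moves heights `±1` inside. The bound on `t` below yields the parabola condition.
  have hc : Continuous fun t : ℝ =>
      (!₂[(2 * n + 3) * t, 2 * t, (1 - t) * v 2] : Space3) := by fun_prop
  have hlim : Tendsto (fun t : ℝ => (!₂[(2 * n + 3) * t, 2 * t, (1 - t) * v 2] : Space3))
      (𝓝[>] 0) (𝓝 v) := by
    refine ((hc.tendsto 0).mono_left nhdsWithin_le_nhds).trans_eq ?_
    congr 1
    exact Space3.ext (by simp [h0]) (by simp [h1]) (by simp)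
  have hn : (0 : ℝ) ≤ n := n.cast_nonneg
  have hε : (0 : ℝ) < 1 / (2 * n + 3) ^ 2 := by positivity
  refine mem_closure_of_tendsto hlim ?_
  filter_upwards [Ioo_mem_nhdsGT hε] with t ht
  have ht1 : (2 * n + 3) ^ 2 * t < 1 := by
    have := (lt_div_iff₀ (by positivity)).1 ht.2
    linarith
  have ht0 := ht.1
  have ht2 : t < 1 := by nlinarith
  have hP : ((2 * n + 3) * t, 2 * t) ∈ sector n := by
    refine ⟨?_, ?_, ?_⟩ <;> simp only <;> nlinarith
  refine ⟨hP, ?_, ?_, Or.inr hP⟩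
  · change -1 < (1 - t) * v 2
    nlinarith
  · change (1 - t) * v 2 < 1
    nlinarith

theorem isOpen_iUnion_sector : IsOpen (⋃ n, sector n) := isOpen_iUnion isOpen_sector

theorem zero_notMem_iUnion_sector : ((0 : ℝ), (0 : ℝ)) ∉ ⋃ n, sector n := fun h => by
  obtain ⟨n, hn⟩ := mem_iUnion.1 h
  exact lt_irrefl _ (sector_bounds hn).1

/-- A box with infinitely many chimneys that have a common edge. -/
def sectorDomain : BoundedDomain Space3 :=
  chimneyDomain openSquare (⋃ n, sector n) isOpen_openSquare convex_openSquare isBounded_openSquare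
    ⟨_, zero_mem_openSquare⟩ isOpen_iUnion_sector ⟨_, zero_notMem_iUnion_sector⟩

theorem chimney_sector_subset (n : ℕ) : chimney (sector n) (sector n) ⊆ sectorDomain.carrier :=
  chimney_self_subset (sector_subset_openSquare n) (subset_iUnion sector n)

/-- The domain is the union of the convex box and the convex sector columns. Every column touches
every boundary point on the common edge; elsewhere only finitely many columns come near. -/
theorem sectorDomain_holds_c : BoundaryCondition.c.Holds sectorDomain := by
  intro r hr x₀ hx₀
  refine notMem_closure_remainder_of_convex hr ?_
  have hsec : ∀ᶠ x in 𝓝 x₀, ∀ n, x ∈ chimney (sector n) (sector n) →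
      x₀ ∈ closure (chimney (sector n) (sector n)) := by
    by_cases h : x₀ 0 = 0 ∧ x₀ 1 = 0
    · have h2 := closure_chimney_subset hx₀.1
      exact Eventually.of_forall fun _ n _ => mem_closure_chimney_sector n h.1 h.2 h2.1 h2.2
    · rcases lt_or_ge 0 (x₀ 0) with hpos | hneg
      · obtain ⟨N, hN⟩ := exists_nat_gt (1 / x₀ 0)
        have h1 : 1 < N * x₀ 0 := (div_lt_iff₀ hpos).1 hN
        have hc : Continuous fun v : Space3 => (N : ℝ) * v 0 := by fun_prop
        filter_upwards [hc.continuousAt.eventually (lt_mem_nhds h1),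
          (eventually_all_finite (finite_lt_nat N)).2 fun n _ =>
            eventually_mem_imp_mem_closure (chimney (sector n) (sector n)) x₀] with x hx hxN n hxn
        refine hxN n ?_ hxn
        obtain ⟨h1, h2, h3, -⟩ := sector_bounds hxn.1
        by_contra! hn
        have hn' : (N : ℝ) ≤ n := by exact_mod_cast hn
        simp only at h1 h2 h3
        nlinarith
      · have h1 : x₀ 0 < |x₀ 1| := by
          rcases hneg.lt_or_eq with h0 | h0
          · exact h0.trans_le (abs_nonneg _)
          · rw [h0]
            exact abs_pos.2 fun h' => h ⟨h0, h'⟩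
        have hev : ∀ᶠ x in 𝓝 x₀, x 0 < |x 1| :=
          (isOpen_lt (by fun_prop) (by fun_prop)).mem_nhds h1
        filter_upwards [hev] with x hx n hxn
        obtain ⟨h1, h2, -⟩ := sector_bounds hxn.1
        simp only at h1 h2
        rw [abs_of_pos h1] at hx
        exact absurd hx h2.not_gt
  filter_upwards [hsec, eventually_mem_imp_mem_closure (chimney openSquare ∅) x₀] with x hx hxB hxΩ
  obtain ⟨h1, h2, h3, h4⟩ := hxΩ
  rcases h4 with h4 | h4
  · have hxB' : x ∈ chimney openSquare ∅ := ⟨h1, h2, h3, Or.inl h4⟩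
    exact ⟨_, convex_chimney_empty convex_openSquare, fun v hv => ⟨hv.1, hv.2.1, hv.2.2.1,
      hv.2.2.2.imp_right fun h => absurd h (notMem_empty _)⟩, hxB', hxB hxB'⟩
  · obtain ⟨n, hn⟩ := mem_iUnion.1 h4
    have hxn : x ∈ chimney (sector n) (sector n) := ⟨hn, h2, h3, Or.inr hn⟩
    exact ⟨_, convex_chimney_self (convex_sector n), chimney_sector_subset n, hxn, hx n hxn⟩

/-- At positive heights the disjoint open columns separate one another, and all of them meet every
neighbourhood of `midPoint`. -/
theorem sectorDomain_not_holds_d : ¬ BoundaryCondition.d.Holds sectorDomain := by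
  intro hd
  have hcl : ∀ n, midPoint ∈ closure (chimney (sector n) (sector n)) := fun n =>
    mem_closure_chimney_sector n rfl rfl (by norm_num) (by norm_num)
  have hmid : midPoint ∈ frontier sectorDomain.carrier :=
    mem_frontier_chimneyDomain.2 ⟨closure_mono (chimney_sector_subset 0) (hcl 0), fun h =>
      zero_notMem_iUnion_sector (midPoint_mem_chimney.1 h).2⟩
  obtain ⟨G, hG, hmG, hGb, hfin⟩ := hd midPoint hmid (1 / 2) (by norm_num)
  have hpt : ∀ n, ∃ v ∈ G, v ∈ chimney (sector n) (sector n) := fun n =>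
    mem_closure_iff.1 (hcl n) G hG hmG
  choose p hpG hpn using hpt
  have hpS : ∀ n, p n ∈ G ∩ sectorDomain.carrier := fun n =>
    ⟨hpG n, chimney_sector_subset n (hpn n)⟩
  have hopen : ∀ n, IsOpen (chimney (sector n) (sector n)) := fun n =>
    isOpen_chimney (isOpen_sector n) (isOpen_sector n)
  refine Set.infinite_of_injective_forall_mem
    (f := fun n => connectedComponentIn (G ∩ sectorDomain.carrier) (p n)) (fun m n hmn => ?_)
    (fun n => connectedComponentIn_mem_componentsOf (hpS n)) hfin
  have hsub : connectedComponentIn (G ∩ sectorDomain.carrier) (p m) ⊆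
      chimney (sector m) (sector m) := by
    refine isPreconnected_connectedComponentIn.subset_left_of_subset_union (hopen m)
      (isOpen_iUnion fun i => isOpen_iUnion fun _ : i ≠ m => hopen i) ?_ ?_
      ⟨p m, mem_connectedComponentIn (hpS m), hpn m⟩
    · refine Set.disjoint_left.2 fun v hv hv' => ?_
      obtain ⟨i, hi, hvi⟩ := mem_iUnion₂.1 hv'
      exact hi (eq_of_mem_sector hvi.1 hv.1)
    · intro v hv
      obtain ⟨hvG, hv1, hv2, hv3, hv4⟩ := connectedComponentIn_subset _ _ hv
      obtain ⟨-, -, h0, -⟩ := abs_lt_of_mem_ball_midPoint (hGb hvG)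
      obtain ⟨i, hi⟩ := mem_iUnion.1 (hv4.resolve_left h0.not_gt)
      have hvi : v ∈ chimney (sector i) (sector i) := ⟨hi, hv2, hv3, Or.inr hi⟩
      by_cases him : i = m
      · exact Or.inl (him ▸ hvi)
      · exact Or.inr (mem_iUnion₂.2 ⟨i, him, hvi⟩)
  have hmem : p n ∈ connectedComponentIn (G ∩ sectorDomain.carrier) (p m) := by
    rw [show connectedComponentIn (G ∩ sectorDomain.carrier) (p m) = _ from hmn]
    exact mem_connectedComponentIn (hpS n)
  exact eq_of_mem_sector (hsub hmem).1 (hpn n).1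

/-! ### Joining points of a set inside a ball by convex pieces -/

section Pieces

theorem IsClosed.eventually_mem_imp_mem {Y : Type*} [TopologicalSpace Y] {S : Set Y}
    (hS : IsClosed S) (x : Y) : ∀ᶠ y in 𝓝 x, y ∈ S → x ∈ S := by
  simpa only [hS.closure_eq] using eventually_mem_imp_mem_closure S x

theorem exists_isPreconnected_of_convex {S P : Set Space3} {x y : Space3} {ε : ℝ} (hε : 0 < ε)
    (hP : Convex ℝ P) (hPS : P ⊆ S) (hx : x ∈ P) (hy : y ∈ P) (hyε : y ∈ ball x ε) :
    ∃ C ⊆ S ∩ ball x ε, IsPreconnected C ∧ x ∈ C ∧ y ∈ C :=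
  ⟨P ∩ ball x ε, inter_subset_inter_left _ hPS, (hP.inter (convex_ball x ε)).isPreconnected,
    ⟨hx, mem_ball_self hε⟩, hy, hyε⟩

theorem exists_isPreconnected_of_convex₂ {S P Q : Set Space3} {x y z : Space3} {ε : ℝ}
    (hε : 0 < ε) (hP : Convex ℝ P) (hPS : P ⊆ S) (hQ : Convex ℝ Q) (hQS : Q ⊆ S) (hx : x ∈ P)
    (hzP : z ∈ P) (hzQ : z ∈ Q) (hy : y ∈ Q) (hzε : z ∈ ball x ε) (hyε : y ∈ ball x ε) :
    ∃ C ⊆ S ∩ ball x ε, IsPreconnected C ∧ x ∈ C ∧ y ∈ C :=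
  ⟨P ∩ ball x ε ∪ Q ∩ ball x ε,
    union_subset (inter_subset_inter_left _ hPS) (inter_subset_inter_left _ hQS),
    (hP.inter (convex_ball x ε)).isPreconnected.union z ⟨hzP, hzε⟩ ⟨hzQ, hzε⟩
      (hQ.inter (convex_ball x ε)).isPreconnected,
    Or.inl ⟨hx, mem_ball_self hε⟩, Or.inr ⟨hy, hyε⟩⟩

theorem isLinearMap_form (a b c : ℝ) :
    IsLinearMap ℝ fun v : Space3 => a * v 0 + b * v 1 + c * v 2 :=
  ⟨fun v w => by simp only [PiLp.add_apply]; ring, fun s v => by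
    simp only [PiLp.smul_apply, smul_eq_mul]; ring⟩

theorem convex_setOf_form_eq (a b c d : ℝ) :
    Convex ℝ {v : Space3 | a * v 0 + b * v 1 + c * v 2 = d} :=
  convex_hyperplane (isLinearMap_form a b c) d

theorem convex_setOf_form_le (a b c d : ℝ) :
    Convex ℝ {v : Space3 | a * v 0 + b * v 1 + c * v 2 ≤ d} :=
  convex_halfSpace_le (isLinearMap_form a b c) d

end Pieces

theorem eventually_sin_inv_ne_zero {x : ℝ} (hx : x ≠ 0) :
    ∀ᶠ y in 𝓝[≠] x, Real.sin y⁻¹ ≠ 0 := by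
  by_cases h : Real.sin x⁻¹ = 0
  · filter_upwards [mem_nhdsWithin_of_mem_nhds (eventually_abs_inv_sub_inv_lt_pi hx),
      self_mem_nhdsWithin] with y hy hyx h'
    exact hyx (eq_of_sin_inv_eq_zero hy h h')
  · exact mem_nhdsWithin_of_mem_nhds ((Real.continuous_sin.continuousAt.comp
      (continuousAt_inv₀ hx)).eventually (isOpen_ne.mem_nhds h))

theorem sin_inv_nonpos_of_mem_uIcc {x y u : ℝ} (hx : 0 < x) (hy : 0 < y)
    (h : |y⁻¹ - x⁻¹| < Real.pi) (hsx : Real.sin x⁻¹ ≤ 0) (hsy : Real.sin y⁻¹ ≤ 0)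
    (hu : u ∈ uIcc x y) : Real.sin u⁻¹ ≤ 0 := by
  wlog hxy : x ≤ y generalizing x y
  · exact this hy hx (by rwa [abs_sub_comm]) hsy hsx (by rwa [uIcc_comm]) (le_of_not_ge hxy)
  rw [uIcc_of_le hxy] at hu
  have hu0 : 0 < u := hx.trans_le hu.1
  have h1 : y⁻¹ ≤ u⁻¹ := inv_anti₀ hu0 hu.2
  have h2 : u⁻¹ ≤ x⁻¹ := inv_anti₀ hx hu.1
  have h3 : x⁻¹ - y⁻¹ < Real.pi := by linarith [(abs_lt.1 h).1]
  by_contra! hpos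
  rcases (h1.trans h2).eq_or_lt with h4 | h4
  · rw [le_antisymm (h2.trans_eq h4.symm) h1] at hpos
    exact hsy.not_gt hpos
  · have h5 : 0 < Real.sin (x⁻¹ - y⁻¹) := Real.sin_pos_of_pos_of_lt_pi (by linarith) h3
    have h6 : 0 ≤ Real.sin (x⁻¹ - u⁻¹) := Real.sin_nonneg_of_nonneg_of_le_pi (by linarith)
      (by linarith)
    have h7 : 0 ≤ Real.sin (u⁻¹ - y⁻¹) := Real.sin_nonneg_of_nonneg_of_le_pi (by linarith)
      (by linarith)
    -- Sine interpolation between the two endpoints: both weights are nonnegative because the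
    -- reciprocals are less than `π` apart, so a positive left side is impossible.
    have h8 : Real.sin u⁻¹ * Real.sin (x⁻¹ - y⁻¹) =
        Real.sin y⁻¹ * Real.sin (x⁻¹ - u⁻¹) + Real.sin x⁻¹ * Real.sin (u⁻¹ - y⁻¹) := by
      simp only [Real.sin_sub]
      ring
    nlinarith [mul_pos hpos h5, mul_nonneg (neg_nonneg.2 hsy) h6,
      mul_nonneg (neg_nonneg.2 hsx) h7]

/-! ### Locally connected boundary, but not locally accessible -/

/-- The open triangle with vertices `(0, 0)`, `(1, 0)` and `(1, 1)`. -/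
def openTriangle : Set (ℝ × ℝ) := {p | 0 < p.2 ∧ p.2 < p.1 ∧ p.1 < 1}

/-- The complement of a sequence of vertical lines and of their limit. -/
def lineComplement : Set (ℝ × ℝ) := {p | p.1 * Real.sin p.1⁻¹ ≠ 0}

theorem isOpen_openTriangle : IsOpen openTriangle :=
  (isOpen_lt continuous_const continuous_snd).inter
    ((isOpen_lt continuous_snd continuous_fst).inter (isOpen_lt continuous_fst continuous_const))

theorem convex_openTriangle : Convex ℝ openTriangle := by
  rintro ⟨x, y⟩ ⟨h1, h2, h3⟩ ⟨x', y'⟩ ⟨h1', h2', h3'⟩ s t hs ht hst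
  simp only at h1 h2 h3 h1' h2' h3'
  refine ⟨?_, ?_, ?_⟩ <;> simp only [Prod.smul_mk, Prod.mk_add_mk, smul_eq_mul] <;>
    rcases hs.eq_or_lt with rfl | hs <;> nlinarith

theorem isBounded_openTriangle : Bornology.IsBounded openTriangle :=
  isBounded_openSquare.subset fun p ⟨h1, h2, h3⟩ =>
    ⟨⟨by linarith, h3⟩, by linarith, by linarith⟩

theorem openTriangle_nonempty : openTriangle.Nonempty :=
  ⟨(1 / 2, 1 / 4), by norm_num [openTriangle]⟩

theorem isOpen_lineComplement : IsOpen lineComplement :=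
  isOpen_ne_fun (continuous_mul_sin_inv.comp continuous_fst) continuous_const

theorem zero_notMem_lineComplement : ((0 : ℝ), (0 : ℝ)) ∉ lineComplement := by
  simp [lineComplement]

/-- A wedge with plates removed whose sizes tend to zero. -/
def plateDomain : BoundedDomain Space3 :=
  chimneyDomain openTriangle lineComplement isOpen_openTriangle convex_openTriangle
    isBounded_openTriangle openTriangle_nonempty isOpen_lineComplement
    ⟨_, zero_notMem_lineComplement⟩

/-- The closed prism that is the closure of `plateDomain`. -/
def closedPrism : Set Space3 :=
  {v | 0 ≤ v 1 ∧ v 1 ≤ v 0 ∧ v 0 ≤ 1 ∧ -1 ≤ v 2 ∧ v 2 ≤ 1}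

theorem isClosed_closedPrism : IsClosed closedPrism := by
  have hc : ∀ i, Continuous fun u : Space3 => u i := fun i => by fun_prop
  exact (isClosed_le continuous_const (hc 1)).inter ((isClosed_le (hc 1) (hc 0)).inter
    ((isClosed_le (hc 0) continuous_const).inter
      ((isClosed_le continuous_const (hc 2)).inter (isClosed_le (hc 2) continuous_const))))

theorem convex_closedPrism : Convex ℝ closedPrism := by
  rintro v ⟨h1, h2, h3, h4, h5⟩ w ⟨h1', h2', h3', h4', h5'⟩ s t hs ht hst
  refine ⟨?_, ?_, ?_, ?_, ?_⟩ <;>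
    simp only [PiLp.add_apply, PiLp.smul_apply, smul_eq_mul] <;> nlinarith

theorem closure_plateDomain : closure plateDomain.carrier = closedPrism := by
  refine Subset.antisymm (closure_minimal ?_ isClosed_closedPrism) ?_
  · rintro v ⟨⟨h1, h2, h3⟩, h4, h5, -⟩
    exact ⟨h1.le, h2.le, h3.le, h4.le, h5.le⟩
  -- The plates are thin: increasing the first coordinate slightly leaves the zeros of the sine. All
  -- other points of the prism are reached by shrinking towards `(1/2, 1/4, 0)`.
  have hopen : ∀ v : Space3, (v 0, v 1) ∈ openTriangle → -1 < v 2 → v 2 < 1 →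
      v ∈ closure plateDomain.carrier := by
    rintro v ⟨h1, h2, h3⟩ h4 h5
    simp only at h1 h2 h3
    have h0 : 0 < v 0 := h1.trans h2
    have hc : Continuous fun t : ℝ => (!₂[t, v 1, v 2] : Space3) := by fun_prop
    have hlim : Tendsto (fun t : ℝ => (!₂[t, v 1, v 2] : Space3)) (𝓝[>] (v 0)) (𝓝 v) := by
      refine ((hc.tendsto (v 0)).mono_left nhdsWithin_le_nhds).trans_eq ?_
      congr 1
      exact Space3.ext rfl rfl rfl
    refine mem_closure_of_tendsto hlim ?_
    filter_upwards [Ioo_mem_nhdsGT h3, nhdsWithin_mono (v 0) (fun t (ht : v 0 < t) => ht.ne')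
      (eventually_sin_inv_ne_zero h0.ne')] with t ht hsin
    exact ⟨⟨h1, h2.trans ht.1, ht.2⟩, h4, h5, Or.inr (mul_ne_zero (h0.trans ht.1).ne' hsin)⟩
  rintro v ⟨h1, h2, h3, h4, h5⟩
  have hc : Continuous fun t : ℝ =>
      (!₂[(1 - t) * v 0 + t / 2, (1 - t) * v 1 + t / 4, (1 - t) * v 2] : Space3) := by fun_prop
  have hlim : Tendsto (fun t : ℝ =>
      (!₂[(1 - t) * v 0 + t / 2, (1 - t) * v 1 + t / 4, (1 - t) * v 2] : Space3))
      (𝓝[>] 0) (𝓝 v) := by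
    refine ((hc.tendsto 0).mono_left nhdsWithin_le_nhds).trans_eq ?_
    congr 1
    exact Space3.ext (by simp) (by simp) (by simp)
  rw [← closure_closure]
  refine mem_closure_of_tendsto hlim ?_
  filter_upwards [Ioo_mem_nhdsGT one_pos] with t ht
  obtain ⟨ht0, ht1⟩ := ht
  refine hopen _ ⟨?_, ?_, ?_⟩ ?_ ?_
  · change 0 < (1 - t) * v 1 + t / 4
    nlinarith
  · change (1 - t) * v 1 + t / 4 < (1 - t) * v 0 + t / 2
    nlinarith
  · change (1 - t) * v 0 + t / 2 < 1
    nlinarith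
  · change -1 < (1 - t) * v 2
    nlinarith
  · change (1 - t) * v 2 < 1
    nlinarith

theorem mem_frontier_plateDomain {v : Space3} :
    v ∈ frontier plateDomain.carrier ↔ v ∈ closedPrism ∧ (v 1 = 0 ∨ v 1 = v 0 ∨ v 0 = 1 ∨
      v 2 = -1 ∨ v 2 = 1 ∨ (0 ≤ v 2 ∧ v 0 * Real.sin (v 0)⁻¹ = 0)) := by
  rw [mem_frontier_chimneyDomain, closure_plateDomain]
  refine and_congr_right fun ⟨h1, h2, h3, h4, h5⟩ => ⟨fun h => ?_, ?_⟩
  · by_contra! hcon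
    obtain ⟨c1, c2, c3, c4, c5, c6⟩ := hcon
    refine h ⟨⟨h1.lt_of_ne' c1, h2.lt_of_ne c2, h3.lt_of_ne c3⟩, h4.lt_of_ne' c4, h5.lt_of_ne c5,
      ?_⟩
    exact (lt_or_ge (v 2) 0).imp_right c6
  · rintro h ⟨⟨c1, c2, c3⟩, c4, c5, c6⟩
    simp only at c1 c2 c3
    rcases h with h | h | h | h | h | ⟨h, h'⟩
    · exact c1.ne' h
    · exact c2.ne h
    · exact c3.ne h
    · exact c4.ne' h
    · exact c5.ne h
    · exact (c6.resolve_left h.not_gt) h'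

/-- The boundary consists of convex faces and convex plates. The plates accumulate only at the edge
over the origin, and each is attached to the face `v 1 = 0`. -/
theorem plateDomain_holds_f : BoundaryCondition.f.Holds plateDomain := by
  refine locallyConnectedSpace_of_connectedImKleinenAt fun v hv ε hε => ?_
  have piece : ∀ a b c d : ℝ, Convex ℝ (closedPrism ∩ {u | a * u 0 + b * u 1 + c * u 2 = d}) :=
    fun a b c d => convex_closedPrism.inter (convex_setOf_form_eq a b c d)
  have sub : ∀ a b c d : ℝ, (∀ u : Space3, a * u 0 + b * u 1 + c * u 2 = d → u 1 = 0 ∨ u 1 = u 0 ∨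
      u 0 = 1 ∨ u 2 = -1 ∨ u 2 = 1) →
      closedPrism ∩ {u | a * u 0 + b * u 1 + c * u 2 = d} ⊆ frontier plateDomain.carrier := by
    rintro a b c d h u ⟨huK, hu⟩
    refine mem_frontier_plateDomain.2 ⟨huK, ?_⟩
    rcases h u hu with h | h | h | h | h <;> simp [h]
  have sub1 := sub 0 1 0 0 fun u hu => Or.inl (by linarith)
  have sub2 := sub 1 (-1) 0 0 fun u hu => Or.inr (Or.inl (by linarith))
  have sub3 := sub 1 0 0 1 fun u hu => Or.inr (Or.inr (Or.inl (by linarith)))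
  have sub4 := sub 0 0 1 (-1) fun u hu => Or.inr (Or.inr (Or.inr (Or.inl (by linarith))))
  have sub5 := sub 0 0 1 1 fun u hu => Or.inr (Or.inr (Or.inr (Or.inr (by linarith))))
  have plate : ∀ x : ℝ, Convex ℝ (closedPrism ∩ {u | 1 * u 0 + 0 * u 1 + 0 * u 2 = x} ∩
      {u | 0 * u 0 + 0 * u 1 + (-1) * u 2 ≤ 0}) := fun x =>
    (piece 1 0 0 x).inter (convex_setOf_form_le 0 0 (-1) 0)
  have subp : ∀ x : ℝ, x * Real.sin x⁻¹ = 0 →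
      closedPrism ∩ {u | 1 * u 0 + 0 * u 1 + 0 * u 2 = x} ∩
      {u | 0 * u 0 + 0 * u 1 + (-1) * u 2 ≤ 0} ⊆ frontier plateDomain.carrier := by
    rintro x hx u ⟨⟨huK, hu⟩, hu2⟩
    obtain rfl : u 0 = x := by linarith [show 1 * u 0 + 0 * u 1 + 0 * u 2 = x from hu]
    exact mem_frontier_plateDomain.2 ⟨huK, by
      have : 0 ≤ u 2 := by linarith [show 0 * u 0 + 0 * u 1 + (-1) * u 2 ≤ 0 from hu2]
      tauto⟩
  have mem_plate : ∀ {x : ℝ} {u : Space3}, u ∈ closedPrism → u 0 = x → 0 ≤ u 2 →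
      u ∈ closedPrism ∩ {u | 1 * u 0 + 0 * u 1 + 0 * u 2 = x} ∩
        {u | 0 * u 0 + 0 * u 1 + (-1) * u 2 ≤ 0} := fun hu h0 h2 =>
    ⟨⟨hu, by simp [h0]⟩, by simpa using h2⟩
  have hc : ∀ i, Continuous fun u : Space3 => u i := fun i => by fun_prop
  have ev1 := (isClosed_eq (hc 1) continuous_const (g := fun _ => 0)).eventually_mem_imp_mem v
  have ev2 := (isClosed_eq (hc 1) (hc 0)).eventually_mem_imp_mem v
  have ev3 := (isClosed_eq (hc 0) continuous_const (g := fun _ => 1)).eventually_mem_imp_mem v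
  have ev4 := (isClosed_eq (hc 2) continuous_const (g := fun _ => -1)).eventually_mem_imp_mem v
  have ev5 := (isClosed_eq (hc 2) continuous_const (g := fun _ => 1)).eventually_mem_imp_mem v
  have ev6 := (isClosed_le continuous_const (hc 2) (f := fun _ => 0)).eventually_mem_imp_mem v
  obtain ⟨hvK, -⟩ := mem_frontier_plateDomain.1 hv
  rcases (hvK.1.trans hvK.2.1).eq_or_lt with hv0 | hv0
  · have hv1 : v 1 = 0 := le_antisymm (hvK.2.1.trans_eq hv0.symm) hvK.1
    filter_upwards [ball_mem_nhds v hε, ev3] with w hwε e3 hw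
    obtain ⟨hwK, hw⟩ := mem_frontier_plateDomain.1 hw
    have hw0 : 0 ≤ w 0 := hwK.1.trans hwK.2.1
    -- At the edge, `w` is joined first to its projection on the face `v 1 = 0`, no farther from `v`
    -- than `w`, and then within that face to `v`.
    let z : Space3 := !₂[w 0, 0, w 2]
    have hzK : z ∈ closedPrism := ⟨le_rfl, hw0, hwK.2.2⟩
    have hzε : z ∈ ball v ε := by
      refine mem_ball.2 (lt_of_le_of_lt (Space3.dist_le_dist (w := w) le_rfl ?_ le_rfl)
        (mem_ball.1 hwε))
      rw [hv1, show z 1 = 0 from rfl, sub_zero, abs_zero]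
      exact abs_nonneg _
    have two : ∀ Q : Set Space3, Convex ℝ Q → Q ⊆ frontier plateDomain.carrier → z ∈ Q → w ∈ Q →
        ∃ C ⊆ frontier plateDomain.carrier ∩ ball v ε, IsPreconnected C ∧ v ∈ C ∧ w ∈ C :=
      fun Q hQ hQS hzQ hwQ => exists_isPreconnected_of_convex₂ hε (piece 0 1 0 0) sub1 hQ hQS
        ⟨hvK, by simp [hv1]⟩ ⟨hzK, by simp [z]⟩ hzQ hwQ hzε hwε
    rcases hw with h | h | h | h | h | ⟨h, h'⟩
    · exact exists_isPreconnected_of_convex hε (piece 0 1 0 0) sub1 ⟨hvK, by simp [hv1]⟩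
        ⟨hwK, by simp [h]⟩ hwε
    · exact exists_isPreconnected_of_convex hε (piece 1 (-1) 0 0) sub2
        ⟨hvK, by simp [hv1, ← hv0]⟩ ⟨hwK, by simp [h]⟩ hwε
    · exact absurd (hv0.trans (e3 h)) zero_ne_one
    · exact two _ (piece 0 0 1 (-1)) sub4 ⟨hzK, by simp [z, h]⟩ ⟨hwK, by simp [h]⟩
    · exact two _ (piece 0 0 1 1) sub5 ⟨hzK, by simp [z, h]⟩ ⟨hwK, by simp [h]⟩
    · exact two _ (plate (w 0)) (subp (w 0) h') (mem_plate hzK rfl h) (mem_plate hwK rfl h)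
  -- Away from the edge the plates are locally isolated, so the convex piece containing a nearby `w`
  -- also contains `v`.
  · have ev7 := (isClosed_eq (continuous_mul_sin_inv.comp (hc 0)) continuous_const
      (g := fun _ => 0)).eventually_mem_imp_mem v
    have ev8 := (hc 0).continuousAt.eventually (eventually_abs_inv_sub_inv_lt_pi hv0.ne')
    have ev9 := (hc 0).continuousAt.eventually (lt_mem_nhds hv0)
    filter_upwards [ball_mem_nhds v hε, ev1, ev2, ev3, ev4, ev5, ev6, ev7, ev8, ev9] with
      w hwε e1 e2 e3 e4 e5 e6 e7 e8 e9 hw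
    obtain ⟨hwK, hw⟩ := mem_frontier_plateDomain.1 hw
    rcases hw with h | h | h | h | h | ⟨h, h'⟩
    · exact exists_isPreconnected_of_convex hε (piece 0 1 0 0) sub1
        ⟨hvK, by simpa using e1 h⟩ ⟨hwK, by simp [h]⟩ hwε
    · exact exists_isPreconnected_of_convex hε (piece 1 (-1) 0 0) sub2
        ⟨hvK, by simp [show v 1 = v 0 from e2 h]⟩ ⟨hwK, by simp [h]⟩ hwε
    · exact exists_isPreconnected_of_convex hε (piece 1 0 0 1) sub3
        ⟨hvK, by simpa using e3 h⟩ ⟨hwK, by simp [h]⟩ hwε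
    · exact exists_isPreconnected_of_convex hε (piece 0 0 1 (-1)) sub4
        ⟨hvK, by simpa using e4 h⟩ ⟨hwK, by simp [h]⟩ hwε
    · exact exists_isPreconnected_of_convex hε (piece 0 0 1 1) sub5
        ⟨hvK, by simpa using e5 h⟩ ⟨hwK, by simp [h]⟩ hwε
    · have hv' : v 0 * Real.sin (v 0)⁻¹ = 0 := e7 h'
      have heq : w 0 = v 0 := eq_of_sin_inv_eq_zero e8
        ((mul_eq_zero.1 hv').resolve_left hv0.ne') ((mul_eq_zero.1 h').resolve_left e9.ne')
      exact exists_isPreconnected_of_convex hε (plate (v 0)) (subp (v 0) hv')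
        (mem_plate hvK rfl (e6 h)) (mem_plate hwK heq h) hwε

/-- Inside the ball every component is blocked by a plate from approaching the edge, so all of the
ball's intersection with the domain belongs to the remainder. -/
theorem plateDomain_not_holds_c : ¬ BoundaryCondition.c.Holds plateDomain := by
  intro hc
  have hmK : midPoint ∈ closedPrism := by
    refine ⟨?_, ?_, ?_, ?_, ?_⟩ <;> simp <;> norm_num
  refine hc (1 / 2) (by norm_num) midPoint
    (mem_frontier_plateDomain.2 ⟨hmK, Or.inl rfl⟩) ?_
  have hcl : midPoint ∈ closure (ball midPoint (1 / 2) ∩ plateDomain.carrier) :=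
    isOpen_ball.inter_closure ⟨mem_ball_self (by norm_num), by rwa [closure_plateDomain]⟩
  refine closure_mono (fun y hy => mem_remainder_iff.2 ⟨hy, fun hcly => ?_⟩) hcl
  have hy0 : 0 < y 0 := hy.2.1.1.trans hy.2.1.2.1
  obtain ⟨x, hx0, hxy, hx⟩ := exists_sin_inv_eq 0 hy0
  have hU : IsOpen {u : Space3 | u 0 < x} := isOpen_lt (by fun_prop) continuous_const
  obtain ⟨u, hux, huC⟩ := mem_closure_iff.1 hcly _ hU hx0
  obtain ⟨w, hwC, rfl⟩ := isPreconnected_connectedComponentIn.exists_coord_eq huC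
    (mem_connectedComponentIn hy) 0 (le_of_lt hux) hxy.le
  obtain ⟨hwb, hwΩ⟩ := connectedComponentIn_subset _ _ hwC
  refine (hwΩ.2.2.2.resolve_left (abs_lt_of_mem_ball_midPoint hwb).2.2.1.not_gt) ?_
  simp [hx]

/-! ### Locally connected complement, but the boundary is not locally connected -/

/-- A sequence of separated trapezoids converging to the origin. -/
def trapezoids : Set (ℝ × ℝ) := {p | 0 < p.2 ∧ p.2 < p.1 ∧ 0 < p.1 * Real.sin p.1⁻¹}

theorem isOpen_trapezoids : IsOpen trapezoids :=
  (isOpen_lt continuous_const continuous_snd).inter ((isOpen_lt continuous_snd continuous_fst).inter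
    (isOpen_lt continuous_const (continuous_mul_sin_inv.comp continuous_fst)))

theorem zero_notMem_trapezoids : ((0 : ℝ), (0 : ℝ)) ∉ trapezoids := fun h => lt_irrefl _ h.1

/-- A box with separated chimneys that converge to a segment. -/
def trapezoidDomain : BoundedDomain Space3 :=
  chimneyDomain openSquare trapezoids isOpen_openSquare convex_openSquare isBounded_openSquare
    ⟨_, zero_mem_openSquare⟩ isOpen_trapezoids ⟨_, zero_notMem_trapezoids⟩

/-- The complement is made of exterior half-spaces, two wedge-shaped regions above height `0`, and
the gaps between columns. The gaps are attached to the region `v 1 ≤ 0`, so near the limit edge they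
can be left through it. -/
theorem trapezoidDomain_holds_g : BoundaryCondition.g.Holds trapezoidDomain := by
  refine locallyConnectedSpace_of_connectedImKleinenAt fun v _ ε hε => ?_
  have hc : ∀ i, Continuous fun u : Space3 => u i := fun i => by fun_prop
  have piece : ∀ P : Set Space3, Convex ℝ P → IsClosed P → P ⊆ trapezoidDomain.carrierᶜ →
      ∀ᶠ w in 𝓝 v, w ∈ P →
        ∃ C ⊆ trapezoidDomain.carrierᶜ ∩ ball v ε, IsPreconnected C ∧ v ∈ C ∧ w ∈ C := by
    intro P hP hPc hPS
    filter_upwards [ball_mem_nhds v hε, hPc.eventually_mem_imp_mem v] with w hwε hw hwP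
    exact exists_isPreconnected_of_convex hε hP hPS (hw hwP) hwP hwε
  have half : ∀ a b c d : ℝ, IsClosed {u : Space3 | a * u 0 + b * u 1 + c * u 2 ≤ d} :=
    fun a b c d => isClosed_le (by fun_prop) continuous_const
  have face : ∀ a b c : ℝ,
      (∀ u ∈ trapezoidDomain.carrier, -1 < a * u 0 + b * u 1 + c * u 2) →
      ∀ᶠ w in 𝓝 v, w ∈ {u : Space3 | a * u 0 + b * u 1 + c * u 2 ≤ -1} →
        ∃ C ⊆ trapezoidDomain.carrierᶜ ∩ ball v ε, IsPreconnected C ∧ v ∈ C ∧ w ∈ C :=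
    fun a b c h => piece _ (convex_setOf_form_le a b c (-1)) (half a b c (-1))
      fun u hu huΩ => (h u huΩ).not_ge hu
  have f1 := face 1 0 0 fun u hu => by linarith [hu.1.1.1]
  have f2 := face (-1) 0 0 fun u hu => by linarith [hu.1.1.2]
  have f3 := face 0 1 0 fun u hu => by linarith [hu.1.2.1]
  have f4 := face 0 (-1) 0 fun u hu => by linarith [hu.1.2.2]
  have f5 := face 0 0 1 fun u hu => by linarith [hu.2.1]
  have f6 := face 0 0 (-1) fun u hu => by linarith [hu.2.2.1]
  have hupc : Convex ℝ {u : Space3 | 0 ≤ u 2} := by simpa using convex_setOf_form_le 0 0 (-1) 0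
  have hupcl : IsClosed {u : Space3 | 0 ≤ u 2} := isClosed_le continuous_const (hc 2)
  let N : Set Space3 := {u | 0 ≤ u 2} ∩ {u | u 1 ≤ 0}
  have hNc : Convex ℝ N := hupc.inter (by simpa using convex_setOf_form_le 0 1 0 0)
  have hNcl : IsClosed N := hupcl.inter (isClosed_le (hc 1) continuous_const)
  have hNS : N ⊆ trapezoidDomain.carrierᶜ := by
    rintro u ⟨h2, h1⟩ hu
    exact (hu.2.2.2.resolve_left (not_lt.2 h2)).1.not_ge h1
  have f7 := piece N hNc hNcl hNS
  have f8 := piece ({u | 0 ≤ u 2} ∩ {u | u 0 ≤ u 1}) (hupc.inter (by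
      simpa [← sub_eq_add_neg] using convex_setOf_form_le 1 (-1) 0 0))
    (hupcl.inter (isClosed_le (hc 0) (hc 1))) (by
      rintro u ⟨h2, h1⟩ hu
      exact (hu.2.2.2.resolve_left (not_lt.2 h2)).2.1.not_ge h1)
  have strip : ∀ x y : ℝ, (∀ t ∈ uIcc x y, t * Real.sin t⁻¹ ≤ 0) →
      ({u : Space3 | 0 ≤ u 2} ∩ {u | u 0 ∈ uIcc x y}) ⊆ trapezoidDomain.carrierᶜ := by
    rintro x y h u ⟨h2, h0⟩ hu
    exact (hu.2.2.2.resolve_left (not_lt.2 h2)).2.2.not_ge (h _ h0)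
  have hstrip : ∀ x y : ℝ, Convex ℝ ({u : Space3 | 0 ≤ u 2} ∩ {u | u 0 ∈ uIcc x y}) := fun x y =>
    hupc.inter ((convex_uIcc x y).is_linear_preimage (f := fun u : Space3 => u 0)
      ⟨fun _ _ => rfl, fun _ _ => rfl⟩)
  have ev0 := (isClosed_le continuous_const (hc 0) (f := fun _ => 0)).eventually_mem_imp_mem v
  have ev1 := (isClosed_le continuous_const (hc 1) (f := fun _ => 0)).eventually_mem_imp_mem v
  have ev2 := (isClosed_le (hc 1) (hc 0)).eventually_mem_imp_mem v
  have ev3 := hupcl.eventually_mem_imp_mem v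
  have ev4 := (isClosed_le (continuous_mul_sin_inv.comp (hc 0)) continuous_const
    (g := fun _ => 0)).eventually_mem_imp_mem v
  have ev5 : ∀ᶠ w in 𝓝 v, v 0 ≠ 0 → |(w 0)⁻¹ - (v 0)⁻¹| < Real.pi := by
    by_cases h : v 0 = 0
    · exact Eventually.of_forall fun _ h' => absurd h h'
    · filter_upwards [(hc 0).continuousAt.eventually (eventually_abs_inv_sub_inv_lt_pi h)] with w hw
      exact fun _ => hw
  filter_upwards [ball_mem_nhds v hε, f1, f2, f3, f4, f5, f6, f7, f8, ev0, ev1, ev2, ev3, ev4,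
    ev5] with w hwε f1 f2 f3 f4 f5 f6 f7 f8 e0 e1 e2 e3 e4 e5 hw
  by_contra hno
  have g1 : -1 < w 0 := by by_contra! h; exact hno (f1 (by simpa using h))
  have g2 : w 0 < 1 := by by_contra! h; exact hno (f2 (by simpa using h))
  have g3 : -1 < w 1 := by by_contra! h; exact hno (f3 (by simpa using h))
  have g4 : w 1 < 1 := by by_contra! h; exact hno (f4 (by simpa using h))
  have g5 : -1 < w 2 := by by_contra! h; exact hno (f5 (by simpa using h))
  have g6 : w 2 < 1 := by by_contra! h; exact hno (f6 (by simpa using h))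
  have hw2 : 0 ≤ w 2 := by
    by_contra! h
    exact hw ⟨⟨⟨g1, g2⟩, g3, g4⟩, g5, g6, Or.inl h⟩
  have g7 : 0 < w 1 := by by_contra! h; exact hno (f7 ⟨hw2, h⟩)
  have g8 : w 1 < w 0 := by by_contra! h; exact hno (f8 ⟨hw2, h⟩)
  have hw0 : 0 < w 0 := g7.trans g8
  have g9 : w 0 * Real.sin (w 0)⁻¹ ≤ 0 := by
    by_contra! h
    exact hw ⟨⟨⟨g1, g2⟩, g3, g4⟩, g5, g6, Or.inr ⟨g7, g8, h⟩⟩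
  have hv2 : 0 ≤ v 2 := e3 hw2
  rcases (show 0 ≤ v 0 from e0 hw0.le).eq_or_lt with hv0 | hv0
  · have hv1 : v 1 = 0 := le_antisymm ((show v 1 ≤ v 0 from e2 g8.le).trans_eq hv0.symm) (e1 g7.le)
    let z : Space3 := !₂[w 0, 0, w 2]
    have hzε : z ∈ ball v ε := by
      refine mem_ball.2 (lt_of_le_of_lt (Space3.dist_le_dist (w := w) le_rfl ?_ le_rfl)
        (mem_ball.1 hwε))
      rw [hv1, show z 1 = 0 from rfl, sub_zero, abs_zero]
      exact abs_nonneg _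
    -- The strip degenerates to the half-plane with first coordinate `w 0`, which leads from `w` to
    -- its projection `z` in `N`.
    refine hno (exists_isPreconnected_of_convex₂ (z := z) hε hNc hNS (hstrip (w 0) (w 0))
      (strip _ _ fun t ht => ?_) ⟨hv2, hv1.le⟩ ⟨hw2, le_refl (0 : ℝ)⟩ ⟨hw2, left_mem_uIcc⟩
      ⟨hw2, left_mem_uIcc⟩ hzε hwε)
    rw [uIcc_self] at ht
    rwa [show t = w 0 from ht]
  · have hsv : Real.sin (v 0)⁻¹ ≤ 0 := by
      have : v 0 * Real.sin (v 0)⁻¹ ≤ 0 := e4 g9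
      by_contra! h
      exact this.not_gt (mul_pos hv0 h)
    have hsw : Real.sin (w 0)⁻¹ ≤ 0 := by
      by_contra! h
      exact g9.not_gt (mul_pos hw0 h)
    refine hno (exists_isPreconnected_of_convex hε (hstrip (v 0) (w 0))
      (strip _ _ fun t ht => ?_) ⟨hv2, left_mem_uIcc⟩ ⟨hw2, right_mem_uIcc⟩ hwε)
    have ht0 : 0 < t := (lt_inf_iff.2 ⟨hv0, hw0⟩).trans_le ht.1
    exact mul_nonpos_of_nonneg_of_nonpos ht0.le
      (sin_inv_nonpos_of_mem_uIcc hv0 hw0 (e5 hv0.ne') hsv hsw ht)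

theorem mem_frontier_trapezoidDomain {x : ℝ} (hx0 : 0 < x) (hx1 : x < 1)
    (hx : Real.sin x⁻¹ = 1) : (!₂[x, 0, 1 / 2] : Space3) ∈ frontier trapezoidDomain.carrier := by
  refine mem_frontier_chimneyDomain.2 ⟨?_, fun h => ?_⟩
  · have hc : Continuous fun t : ℝ => (!₂[x, t, 1 / 2] : Space3) := by fun_prop
    refine mem_closure_of_tendsto ((hc.tendsto 0).mono_left nhdsWithin_le_nhds)
      (b := 𝓝[>] 0) ?_
    filter_upwards [Ioo_mem_nhdsGT hx0] with t ht
    have hP : (x, t) ∈ trapezoids := ⟨ht.1, ht.2, by simpa [hx] using hx0⟩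
    refine ⟨⟨⟨neg_one_lt_zero.trans hx0, hx1⟩, ?_, ht.2.trans hx1⟩, ?_, ?_, Or.inr hP⟩
    · exact neg_one_lt_zero.trans ht.1
    · change (-1 : ℝ) < 1 / 2
      norm_num
    · change (1 / 2 : ℝ) < 1
      norm_num
  · have h2 : ¬ (1 / 2 : ℝ) < 0 := by norm_num
    exact lt_irrefl _ (h.2.2.2.resolve_left h2).1

/-- Between any two columns there is a gap with sine `-1`, which the boundary avoids at positive
heights; hence no small connected part of the boundary links `midPoint` to a column. -/
theorem trapezoidDomain_not_holds_f : ¬ BoundaryCondition.f.Holds trapezoidDomain := by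
  intro hf
  have : LocallyConnectedSpace ↥(frontier trapezoidDomain.carrier) := hf
  have hex : ∀ δ > 0, ∃ x, 0 < x ∧ x < δ ∧
      (!₂[x, 0, 1 / 2] : Space3) ∈ frontier trapezoidDomain.carrier := by
    intro δ hδ
    obtain ⟨x, hx0, hxδ, hx⟩ := exists_sin_inv_eq (Real.pi / 2) (lt_min hδ one_pos)
    exact ⟨x, hx0, hxδ.trans_le (min_le_left _ _), mem_frontier_trapezoidDomain hx0
      (hxδ.trans_le (min_le_right _ _)) (hx.trans Real.sin_pi_div_two)⟩
  have hmid : midPoint ∈ frontier trapezoidDomain.carrier := by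
    rw [← isClosed_frontier.closure_eq, Metric.mem_closure_iff]
    intro δ hδ
    obtain ⟨x, hx0, hxδ, hx⟩ := hex δ hδ
    exact ⟨_, hx, by rwa [dist_comm, dist_midPoint hx0]⟩
  obtain ⟨δ, hδ, hb⟩ := Metric.eventually_nhds_iff_ball.1
    (connectedImKleinenAt_of_locallyConnectedSpace hmid (1 / 2) (by norm_num))
  obtain ⟨x, hx0, hxδ, hx⟩ := hex δ hδ
  obtain ⟨C, hC, hCp, hmC, hxC⟩ := hb _ (by rwa [mem_ball, dist_midPoint hx0]) hx
  obtain ⟨y, hy0, hyx, hy⟩ := exists_sin_inv_eq (-(Real.pi / 2)) hx0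
  rw [Real.sin_neg, Real.sin_pi_div_two] at hy
  obtain ⟨u, hu, rfl⟩ := hCp.exists_coord_eq hmC hxC 0 (t := y) hy0.le hyx.le
  have hc0 : Continuous fun v : Space3 => v 0 := by fun_prop
  -- This open set misses the domain, so it cannot contain the boundary point `u`.
  have hO : IsOpen ({v : Space3 | v 0 * Real.sin (v 0)⁻¹ < 0} ∩ {v | 0 < v 2}) :=
    (isOpen_lt (continuous_mul_sin_inv.comp hc0) continuous_const).inter
      (isOpen_lt continuous_const (by fun_prop))
  obtain ⟨v, ⟨hv0, hv2⟩, hv⟩ := mem_closure_iff.1 (hC hu).1.1 _ hO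
    ⟨show u 0 * Real.sin (u 0)⁻¹ < 0 by rw [hy]; linarith,
      (abs_lt_of_mem_ball_midPoint (hC hu).2).2.2.1⟩
  exact (hv.2.2.2.resolve_left (not_lt.2 (le_of_lt hv2))).2.2.not_gt hv0

/-! ### From four examples to all missing implications -/

namespace BoundaryCondition

/-- There is a bounded domain in three-space, homeomorphic to a ball, that satisfies the first
condition but not the second. -/
def Separated (i j : BoundaryCondition) : Prop :=
  ∃ Ω : BoundedDomain Space3,
    Nonempty (↥Ω.carrier ≃ₜ ↥(ball (0 : Space3) 1)) ∧ i.Holds Ω ∧ ¬ j.Holds Ω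

theorem Separated.mono {i i' j j' : BoundaryCondition} (h : Separated i j)
    (hi : Relation.ReflTransGen Arrow i i') (hj : Relation.ReflTransGen Arrow j' j) :
    Separated i' j' := by
  obtain ⟨Ω, hΩ, hΩi, hΩj⟩ := h
  exact ⟨Ω, hΩ, Arrow.imp hi Ω hΩi, fun h => hΩj (Arrow.imp hj Ω h)⟩

theorem separated_d_g : Separated d g :=
  ⟨hairyDomain, nonempty_homeomorph_ball isOpen_openSquare convex_openSquare isBounded_openSquare
    ⟨_, zero_mem_openSquare⟩ isOpen_hairComplement ⟨_, zero_notMem_hairComplement⟩,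
    hairyDomain_holds_d, hairyDomain_not_holds_g⟩

theorem separated_c_d : Separated c d :=
  ⟨sectorDomain, nonempty_homeomorph_ball isOpen_openSquare convex_openSquare isBounded_openSquare
    ⟨_, zero_mem_openSquare⟩ isOpen_iUnion_sector ⟨_, zero_notMem_iUnion_sector⟩,
    sectorDomain_holds_c, sectorDomain_not_holds_d⟩

theorem separated_f_c : Separated f c :=
  ⟨plateDomain, nonempty_homeomorph_ball isOpen_openTriangle convex_openTriangle
    isBounded_openTriangle openTriangle_nonempty isOpen_lineComplement
    ⟨_, zero_notMem_lineComplement⟩, plateDomain_holds_f, plateDomain_not_holds_c⟩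

theorem separated_g_f : Separated g f :=
  ⟨trapezoidDomain, nonempty_homeomorph_ball isOpen_openSquare convex_openSquare
    isBounded_openSquare ⟨_, zero_mem_openSquare⟩ isOpen_trapezoids ⟨_, zero_notMem_trapezoids⟩,
    trapezoidDomain_holds_g, trapezoidDomain_not_holds_f⟩

/-- The conditions fall into the classes `{a, b, c}`, `{d, e}`, `{f}`, `{g}`; each ordered pair
either follows the arrows or inherits one of the four separations. -/
theorem reflTransGen_or_separated (i j : BoundaryCondition) :
    Relation.ReflTransGen Arrow i j ∨ Separated i j := by
  have ed := Relation.ReflTransGen.single Arrow.ed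
  have de := Relation.ReflTransGen.single Arrow.de
  have dc := Relation.ReflTransGen.single Arrow.dc
  have cb := Relation.ReflTransGen.single Arrow.cb
  have bc := Relation.ReflTransGen.single Arrow.bc
  have ba := Relation.ReflTransGen.single Arrow.ba
  have ab := Relation.ReflTransGen.single Arrow.ab
  have fg := Relation.ReflTransGen.single Arrow.fg
  have toC : ∀ k, k = a ∨ k = b ∨ k = c ∨ k = d ∨ k = e → Relation.ReflTransGen Arrow k c := by
    rintro k (rfl | rfl | rfl | rfl | rfl)
    exacts [ab.trans bc, bc, .refl, dc, ed.trans dc]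
  have ofC : ∀ k, k = a ∨ k = b ∨ k = c → Relation.ReflTransGen Arrow c k := by
    rintro k (rfl | rfl | rfl)
    exacts [cb.trans ba, cb, .refl]
  have ofD : ∀ k, k = a ∨ k = b ∨ k = c ∨ k = d ∨ k = e → Relation.ReflTransGen Arrow d k := by
    rintro k (rfl | rfl | rfl | rfl | rfl)
    exacts [dc.trans (ofC a (by simp)), dc.trans cb, dc, .refl, de]
  have toD : ∀ k, k = d ∨ k = e → Relation.ReflTransGen Arrow k d := by
    rintro k (rfl | rfl)
    exacts [.refl, ed]
  have ofF : ∀ k, k = f ∨ k = g → Relation.ReflTransGen Arrow f k := by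
    rintro k (rfl | rfl)
    exacts [.refl, fg]
  have toG : ∀ k, k = f ∨ k = g → Relation.ReflTransGen Arrow k g := by
    rintro k (rfl | rfl)
    exacts [fg, .refl]
  cases i <;> cases j <;> first
    | exact Or.inl .refl
    | exact Or.inl fg
    | (refine Or.inl ((toC _ ?_).trans (ofC _ ?_)) <;> simp <;> done)
    | (refine Or.inl ((toD _ ?_).trans (ofD _ ?_)) <;> simp <;> done)
    | (refine Or.inr (separated_d_g.mono (ofD _ ?_) (toG _ ?_)) <;> simp <;> done)
    | (refine Or.inr (separated_c_d.mono (ofC _ ?_) (toD _ ?_)) <;> simp <;> done)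
    | (refine Or.inr (separated_f_c.mono (ofF _ ?_) (toC _ ?_)) <;> simp <;> done)
    | exact Or.inr separated_g_f

end BoundaryCondition

theorem mainTheorem5 :
    (∀ (X : Type*) [MetricSpace X] [ProperSpace X] [LocallyConnectedSpace X]
        (Ω : BoundedDomain X),
      (BoundaryCondition.e.Holds Ω ↔ BoundaryCondition.d.Holds Ω) ∧
      (BoundaryCondition.d.Holds Ω → BoundaryCondition.c.Holds Ω) ∧
      (BoundaryCondition.c.Holds Ω ↔ BoundaryCondition.b.Holds Ω) ∧
      (BoundaryCondition.b.Holds Ω ↔ BoundaryCondition.a.Holds Ω) ∧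
      (BoundaryCondition.f.Holds Ω → BoundaryCondition.g.Holds Ω)) ∧
    (∀ i j : BoundaryCondition, ¬ Relation.ReflTransGen BoundaryCondition.Arrow i j →
      ∃ Ω : BoundedDomain (EuclideanSpace ℝ (Fin 3)),
        Nonempty (↥Ω.carrier ≃ₜ ↥(ball (0 : EuclideanSpace ℝ (Fin 3)) 1)) ∧
        i.Holds Ω ∧ ¬ j.Holds Ω) := by
  refine ⟨fun X _ _ _ Ω => ⟨BoundaryCondition.e_iff_d Ω, BoundaryCondition.c_of_d Ω,
    ⟨BoundaryCondition.b_of_c Ω, fun h => BoundaryCondition.c_of_a Ω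
      (BoundaryCondition.a_of_b Ω h)⟩,
    ⟨BoundaryCondition.a_of_b Ω, fun h => BoundaryCondition.b_of_c Ω
      (BoundaryCondition.c_of_a Ω h)⟩, BoundaryCondition.g_of_f Ω⟩, fun i j hij => ?_⟩
  exact (BoundaryCondition.reflTransGen_or_separated i j).resolve_left hij
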